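/- Call a finite simple undirected graph \(G=(V,E)\) a bounded degree-3 graph if it has at least one vertex of degree \(3\) and no vertex of degree greater than \(3\). An interval is a set \(I=[a,b]=\{x\in\mathbb{R}\mid a\le x\le b\}\) with real \(a\le b\), and \(l(I)=a\), \(r(I)=b\) are its endpoints. A 2-interval representation of \(G\) assigns to the vertices \(u\in V\) pairwise different sets \(\mathcal{I}_u\) of at most two intervals such that any two distinct vertices \(u,w\) are adjacent if and only if some interval of \(\mathcal{I}_u\) intersects some interval of \(\mathcal{I}_w\). For every bounded degree-3 graph \(G\) there is a 2-interval representation of \(G\) such that for every \(u\in V\), \(\mathcal{I}_u=\{I_u^1,I_u^2\}\) satisfies one of the following: 1. \(I_u^1=[x_1,x_1]\), \(I_u^2=[x_2,x_3]\), \(x_1<x_2<x_3\), and there are no \(u'\in V\setminus\{u\}\) and \(J\in\mathcal{I}_{u'}\) such that \(r(J)\in(x_2,x_3)\) or \(l(J)\in(x_2,x_3)\); 2. \(I_u^1=[x_1,x_2]\), \(I_u^2=[x_3,x_3]\), \(x_1<x_2<x_3\), and there are no \(u'\in V\setminus\{u\}\) and \(J\in\mathcal{I}_{u'}\) such that \(r(J)\in(x_1,x_2)\)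 or \(l(J)\in(x_1,x_2)\); where \((a,b)=\{x\in\mathbb{R}\mid a<x<b\}\). Moreover, such a 2-interval representation can be found in polynomial time: there are an algorithm and a polynomial \(q\) such that, on the adjacency matrix of any bounded degree-3 graph with \(n\) vertices, the algorithm stops after at most \(q(n)\) steps and outputs the endpoints of the intervals of such a representation. -/

import Mathlib

/-! ### Interval representations of graphs

An interval `[a, b]` with real `a ≤ b` is a `NonemptyInterval ℝ`; its left endpoint is `I.fst`, its
right endpoint is `I.snd`, and as a set of reals it is `Set.Icc I.fst I.snd`. -/

/-- Two families of intervals intersect: some interval of one meets some interval of the other. -/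
def FamiliesMeet (A B : Set (NonemptyInterval ℝ)) : Prop :=
  ∃ I ∈ A, ∃ J ∈ B, (Set.Icc I.fst I.snd ∩ Set.Icc J.fst J.snd).Nonempty

/-- `f` is a `t`-interval representation of `G`: it assigns to the vertices pairwise different
`t`-intervals (so it is a bijection onto the set of the `t`-intervals used), and two vertices are
adjacent exactly when their `t`-intervals intersect. -/
structure IsIntervalRepresentation {V : Type*} (G : SimpleGraph V) (t : ℕ)
    (f : V → Set (NonemptyInterval ℝ)) : Prop where
  encard_le : ∀ u, (f u).encard ≤ t
  injective : Function.Injective f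
  adj_iff : ∀ u w, u ≠ w → (G.Adj u w ↔ FamiliesMeet (f u) (f w))

/-- No endpoint of an interval of a vertex other than `u` lies strictly inside `I`. -/
def NoForeignEndpointInside {V : Type*} (f : V → Set (NonemptyInterval ℝ)) (u : V)
    (I : NonemptyInterval ℝ) : Prop :=
  ∀ u', u' ≠ u → ∀ J ∈ f u', J.snd ∉ Set.Ioo I.fst I.snd ∧ J.fst ∉ Set.Ioo I.fst I.snd

/-- The vertex `u` is represented by a trivial interval and a proper interval which are disjoint,
and no endpoint of an interval of another vertex lies strictly inside the proper one. The first
alternative has the trivial interval on the left, the second one has it on the right. -/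
def IsTrivialPlusProper {V : Type*} (f : V → Set (NonemptyInterval ℝ)) (u : V) : Prop :=
  ∃ I₁ I₂ : NonemptyInterval ℝ, f u = {I₁, I₂} ∧
    ((I₁.fst = I₁.snd ∧ I₁.snd < I₂.fst ∧ I₂.fst < I₂.snd ∧ NoForeignEndpointInside f u I₂) ∨
     (I₁.fst < I₁.snd ∧ I₁.snd < I₂.fst ∧ I₂.fst = I₂.snd ∧ NoForeignEndpointInside f u I₁))

/-- A 2-interval representation in which every vertex has a trivial and a proper interval as in
`IsTrivialPlusProper`. -/
def IsSpecialRepresentation {V : Type*} (G : SimpleGraph V)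
    (f : V → Set (NonemptyInterval ℝ)) : Prop :=
  IsIntervalRepresentation G 2 f ∧ ∀ u, IsTrivialPlusProper f u

/-- Some vertex has exactly three neighbours and no vertex has more than three. -/
def IsBoundedDegreeThree {V : Type*} (G : SimpleGraph V) : Prop :=
  (∃ v, (G.neighborSet v).encard = 3) ∧ ∀ v, (G.neighborSet v).encard ≤ 3

/-! ### Random access machines

A random access machine over the natural numbers, with programs in structured form. The only
arithmetic operations are addition and (truncated) subtraction and each instruction and each test
costs one step; with this instruction set the machine and Turing machines simulate each other with
polynomial overhead, so that polynomial time has its usual meaning. -/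

namespace RAM

/-- Contents of the scalar registers and of the arrays: `arr a i` is the cell `i` of array `a`. A
program mentions only finitely many registers and arrays. -/
structure State where
  reg : ℕ → ℕ
  arr : ℕ → ℕ → ℕ

def State.setReg (s : State) (x v : ℕ) : State :=
  { s with reg := Function.update s.reg x v }

def State.setArr (s : State) (a i v : ℕ) : State :=
  { s with arr := Function.update s.arr a (Function.update (s.arr a) i v) }

inductive Program where
  /-- do nothing -/
  | skip : Program
  /-- `x := k` for a constant `k` -/
  | const (x k : ℕ) : Program
  /-- `x := y + z` -/
  | add (x y z : ℕ) : Program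
  /-- `x := y - z`, truncated at zero -/
  | sub (x y z : ℕ) : Program
  /-- `x := a[y]` -/
  | load (x a y : ℕ) : Program
  /-- `a[x] := y` -/
  | store (a x y : ℕ) : Program
  /-- first `p`, then `q` -/
  | seq (p q : Program) : Program
  /-- if `x < y` then `p` else `q` -/
  | ifLt (x y : ℕ) (p q : Program) : Program
  /-- while `x < y` do `p` -/
  | whileLt (x y : ℕ) (p : Program) : Program

/-- `Runs p s t s'`: started in state `s`, the program `p` halts after exactly `t` steps, in
state `s'`. -/
inductive Runs : Program → State → ℕ → State → Prop where
  | skip (s) : Runs .skip s 1 s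
  | const (s x k) : Runs (.const x k) s 1 (s.setReg x k)
  | add (s x y z) : Runs (.add x y z) s 1 (s.setReg x (s.reg y + s.reg z))
  | sub (s x y z) : Runs (.sub x y z) s 1 (s.setReg x (s.reg y - s.reg z))
  | load (s x a y) : Runs (.load x a y) s 1 (s.setReg x (s.arr a (s.reg y)))
  | store (s a x y) : Runs (.store a x y) s 1 (s.setArr a (s.reg x) (s.reg y))
  | seq {p q s t s' t' s''} : Runs p s t s' → Runs q s' t' s'' → Runs (.seq p q) s (t + t') s''
  | ifTrue {x y p q s t s'} : s.reg x < s.reg y → Runs p s t s' →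
      Runs (.ifLt x y p q) s (1 + t) s'
  | ifFalse {x y p q s t s'} : ¬ s.reg x < s.reg y → Runs q s t s' →
      Runs (.ifLt x y p q) s (1 + t) s'
  | whileTrue {x y p s t s' t' s''} : s.reg x < s.reg y → Runs p s t s' →
      Runs (.whileLt x y p) s' t' s'' → Runs (.whileLt x y p) s (1 + t + t') s''
  | whileFalse {x y p s} : ¬ s.reg x < s.reg y → Runs (.whileLt x y p) s 1 s

open Classical in
/-- The input of a graph on the vertices `0, …, n - 1`: register `0` holds `n`, array `0` holds the
adjacency matrix row by row, and everything else is zero. -/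
noncomputable def graphInput {n : ℕ} (G : SimpleGraph (Fin n)) : State where
  reg := fun x => if x = 0 then n else 0
  arr := fun a i => if a = 0 ∧ ∃ u v : Fin n, G.Adj u v ∧ i = (u : ℕ) * n + v then 1 else 0

/-- The state `s` holds the family `f` of pairs of intervals: for each vertex `u`, the cells `u` of
the arrays `1`, `2`, `3`, `4` are the left and the right endpoint of the first and the left and the
right endpoint of the second interval of `u`. -/
def State.Holds {n : ℕ} (s : State) (f : Fin n → Set (NonemptyInterval ℝ)) : Prop :=
  ∀ u : Fin n, ∃ I₁ I₂ : NonemptyInterval ℝ, f u = {I₁, I₂} ∧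
    I₁.fst = s.arr 1 u ∧ I₁.snd = s.arr 2 u ∧ I₂.fst = s.arr 3 u ∧ I₂.snd = s.arr 4 u

end RAM

/-! The vertices are arranged along greedily built maximal paths. The vertex at the integer position
`p` gets the segment `[p, p + 1]`, so neighbours on a path share an endpoint, while different paths
are kept apart. The other edges are realized by one movable point per vertex. Every endpoint is an
integer, hence none lies strictly inside a unit segment.

To add a missing edge `uv`, the point of `u` is moved to `v`: to an end of the segment of `v` that
no other vertex touches or, failing that, onto the point of `v`. The point of `u` must not yet serve
another edge. If both ends of the segment of `u` are used, they already represent two edges at `u`,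
and `uv` is a further one, so the degree bound leaves the point free (`Attached.point_free`).
Otherwise `u` is an end of its path, and the roles are chosen such that `v` also has an unused end
and so is an end of its path. An abandoned path has ends without unplaced neighbours, so adjacent
path ends lie on the same path; hence a path end has at most one neighbour which is a path end
(`PathLayout.unique_free_neighbor`). Thus the point of `u` cannot have been spent on another edge of
this kind. `Attached.attach` carries out the move.

The construction is the algorithm: `PathLayout` and `Attached` enter the loop invariants of a
program with quadratic running time. Existence for an arbitrary finite graph follows by numbering
its vertices. -/

/-! ### Greedy decomposition into maximal paths -/

/-- The position `x` is taken by a vertex below `n`; the position `0` means "not placed". -/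
def Occupied (n : ℕ) (pos : ℕ → ℕ) (x : ℕ) : Prop :=
  0 < x ∧ ∃ w < n, pos w = x

/-- One of the two positions next to `u` is not taken. -/
def HasFreeEnd (n : ℕ) (pos : ℕ → ℕ) (u : ℕ) : Prop :=
  ¬ (Occupied n pos (pos u - 1) ∧ Occupied n pos (pos u + 1))

/-- `k` vertices below `n` are placed such that vertices at consecutive positions are adjacent.
The last path takes the positions from `L` to `R` and has the ends `lo` and `hi`. -/
structure PathLayout (G : SimpleGraph ℕ) (n : ℕ) (pos : ℕ → ℕ) (k lo hi L R : ℕ) : Prop where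
  card : ((Finset.range n).filter fun v => 0 < pos v).card = k
  lo_lt : lo < n
  hi_lt : hi < n
  pos_lo : pos lo = L
  pos_hi : pos hi = R
  pos_of : 0 < L
  inj : ∀ u < n, ∀ v < n, 0 < pos u → pos u = pos v → u = v
  le : ∀ u < n, pos u ≤ R
  occ : ∀ x, L ≤ x → x ≤ R → Occupied n pos x
  -- The gap before the last path stays wide enough for all `n - k` unplaced vertices to be added on
  -- its left, with segments of different paths still disjoint. Unplaced vertices, with position
  -- `0`, are included, which keeps the positions on the left positive.
  room : ∀ u < n, pos u < L → pos u + (n - k) + 1 < L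
  adj : ∀ u < n, ∀ v < n, 0 < pos u → pos v = pos u + 1 → G.Adj u v
  -- Maximality of the earlier paths. Together with `between`, which says that adjacent path ends
  -- lie in one run of positions, it survives all later placements.
  closed : ∀ u < n, 0 < pos u → pos u < L → HasFreeEnd n pos u → ∀ w < n, G.Adj u w → 0 < pos w
  between : ∀ u < n, ∀ v < n, 0 < pos u → pos u < pos v → G.Adj u v → HasFreeEnd n pos u →
    HasFreeEnd n pos v → ∀ x, pos u ≤ x → x ≤ pos v → Occupied n pos x

section Place

variable {n : ℕ} {pos : ℕ → ℕ} {w x : ℕ}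

lemma occupied_update (hw : w < n) (hw0 : pos w = 0) (hx : 0 < x) (y : ℕ) :
    Occupied n (Function.update pos w x) y ↔ Occupied n pos y ∨ y = x := by
  constructor
  · rintro ⟨hy, v, hv, e⟩
    by_cases h : v = w
    · subst h; simp at e; exact Or.inr e.symm
    · rw [Function.update_of_ne h] at e; exact Or.inl ⟨hy, v, hv, e⟩
  · rintro (⟨hy, v, hv, e⟩ | rfl)
    · refine ⟨hy, v, hv, ?_⟩
      have h : v ≠ w := by rintro rfl; omega
      rw [Function.update_of_ne h]; exact e
    · exact ⟨hx, w, hw, by simp⟩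

lemma hasFreeEnd_of_update (hw : w < n) (hw0 : pos w = 0) (hx : 0 < x) {u : ℕ} (hu : u ≠ w)
    (h : HasFreeEnd n (Function.update pos w x) u) : HasFreeEnd n pos u := by
  rintro ⟨h1, h2⟩
  apply h
  rw [Function.update_of_ne hu]
  exact ⟨(occupied_update hw hw0 hx _).2 (Or.inl h1), (occupied_update hw hw0 hx _).2 (Or.inl h2)⟩

lemma card_placed_update (hw : w < n) (hw0 : pos w = 0) (hx : 0 < x) :
    ((Finset.range n).filter fun v => 0 < Function.update pos w x v).card =
      ((Finset.range n).filter fun v => 0 < pos v).card + 1 := by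
  rw [← Finset.card_insert_of_notMem (a := w) (by simp [hw0])]
  congr 1
  ext v
  by_cases h : v = w
  · subst h; simp [hw, hx]
  · simp [h]

end Place

namespace PathLayout

variable {G : SimpleGraph ℕ} {n : ℕ} {pos : ℕ → ℕ} {k lo hi L R w : ℕ}

lemma le_hi (h : PathLayout G n pos k lo hi L R) : L ≤ R := h.pos_lo ▸ h.le lo h.lo_lt

/-- The inner vertices of the last path have no free end. -/
lemma end_of_hasFreeEnd (h : PathLayout G n pos k lo hi L R) {u : ℕ} (hu : u < n)
    (hL : L ≤ pos u) (hf : HasFreeEnd n pos u) : u = lo ∨ u = hi := by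
  have hR := h.le u hu
  have h0 := h.pos_of
  by_contra hc
  rw [not_or] at hc
  have h1 : pos u ≠ L := fun e => hc.1 (h.inj _ hu _ h.lo_lt (by omega) (by rw [e, h.pos_lo]))
  have h2 : pos u ≠ R := fun e => hc.2 (h.inj _ hu _ h.hi_lt (by omega) (by rw [e, h.pos_hi]))
  exact hf ⟨h.occ _ (by omega) (by omega), h.occ _ (by omega) (by omega)⟩

/-- The delicate condition is `between`: an edge from `w` to an end of an earlier path would
contradict `closed`, as `w` was unplaced. An edge from `w` to the last path spans positions of that
path only. -/
lemma place_right (h : PathLayout G n pos k lo hi L R) (hw : w < n) (hw0 : pos w = 0)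
    (ha : G.Adj hi w) : PathLayout G n (Function.update pos w (R + 1)) (k + 1) lo w L (R + 1) := by
  have hx : 0 < R + 1 := by omega
  have hL := h.pos_of
  have hLR := h.le_hi
  have hlo : lo ≠ w := by rintro rfl; have := h.pos_lo; omega
  have hocc := occupied_update (n := n) (pos := pos) hw hw0 hx
  have hfree := fun u => hasFreeEnd_of_update (n := n) (pos := pos) (u := u) hw hw0 hx
  have hval : ∀ u, u ≠ w → Function.update pos w (R + 1) u = pos u := fun u hu =>
    Function.update_of_ne hu _ _
  have hself : Function.update pos w (R + 1) w = R + 1 := by simp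
  have hone : ∀ u, 0 < pos u → u ≠ w := by rintro u hu rfl; omega
  refine ⟨by rw [card_placed_update hw hw0 hx, h.card], h.lo_lt, hw, by rw [hval _ hlo, h.pos_lo],
    hself, hL, ?_, ?_, ?_, ?_, ?_, ?_, ?_⟩
  · intro u hu v hv
    by_cases e1 : u = w <;> by_cases e2 : v = w
    · simp [e1, e2]
    · rw [e1, hself, hval v e2]; intro _ e; have := h.le v hv; omega
    · rw [e2, hself, hval u e1]; intro _ e; have := h.le u hu; omega
    · rw [hval u e1, hval v e2]; exact h.inj u hu v hv
  · intro u hu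
    by_cases e1 : u = w
    · rw [e1, hself]
    · rw [hval u e1]; have := h.le u hu; omega
  · intro x h1 h2
    rw [hocc]
    by_cases e : x = R + 1
    · exact Or.inr e
    · exact Or.inl (h.occ x h1 (by omega))
  · intro u hu
    by_cases e1 : u = w
    · rw [e1, hself]; omega
    · rw [hval u e1]; intro h1; have := h.room u hu h1; omega
  · intro u hu v hv
    by_cases e1 : u = w <;> by_cases e2 : v = w
    · simp [e1, e2]
    · rw [e1, hself, hval v e2]; intro _ e; have := h.le v hv; omega
    · rw [e2, hself, hval u e1]; intro h1 e
      have : u = hi := h.inj u hu hi h.hi_lt h1 (by rw [h.pos_hi]; omega)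
      rw [this]; exact ha
    · rw [hval u e1, hval v e2]; exact h.adj u hu v hv
  · intro u hu h1 h2 h3 v hv h4
    by_cases e1 : u = w
    · rw [e1, hself] at h2; omega
    · rw [hval u e1] at h1 h2
      have := h.closed u hu h1 h2 (hfree u e1 h3) v hv h4
      rw [hval v (hone v this)]; exact this
  · intro u hu v hv h1 h2 h3 h4 h5 x h6 h7
    have hne : u ≠ w := by
      rintro rfl
      rw [hself] at h2
      by_cases e2 : v = u
      · exact h3.ne e2.symm
      · rw [hval v e2] at h2; have := h.le v hv; omega
    rw [hval u hne] at h1 h2 h6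
    rw [hocc]
    by_cases e2 : v = w
    · rw [e2, hself] at h7
      rw [e2] at h3
      by_cases e3 : pos u < L
      · have := h.closed u hu h1 e3 (hfree u hne h4) w hw h3; omega
      · by_cases e : x = R + 1
        · exact Or.inr e
        · exact Or.inl (h.occ x (by omega) (by omega))
    · rw [hval v e2] at h2 h7
      exact Or.inl (h.between u hu v hv h1 h2 h3 (hfree u hne h4) (hfree v e2 h5) x h6 h7)

/-- As for `place_right`, with `room` guaranteeing that the position `L - 1` is positive and not
next to an earlier path. -/
lemma place_left (h : PathLayout G n pos k lo hi L R) (hk : k < n) (hw : w < n) (hw0 : pos w = 0)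
    (ha : G.Adj lo w) : PathLayout G n (Function.update pos w (L - 1)) (k + 1) w hi (L - 1) R := by
  have hL := h.pos_of
  have hroom := h.room w hw (by omega)
  have hx : 0 < L - 1 := by omega
  have hLR := h.le_hi
  have hhi : hi ≠ w := by rintro rfl; have := h.pos_hi; omega
  have hocc := occupied_update (n := n) (pos := pos) hw hw0 hx
  have hfree := fun u => hasFreeEnd_of_update (n := n) (pos := pos) (u := u) hw hw0 hx
  have hval : ∀ u, u ≠ w → Function.update pos w (L - 1) u = pos u := fun u hu =>
    Function.update_of_ne hu _ _
  have hself : Function.update pos w (L - 1) w = L - 1 := by simp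
  have hone : ∀ u, 0 < pos u → u ≠ w := by rintro u hu rfl; omega
  refine ⟨by rw [card_placed_update hw hw0 hx, h.card], hw, h.hi_lt, hself,
    by rw [hval _ hhi, h.pos_hi], hx, ?_, ?_, ?_, ?_, ?_, ?_, ?_⟩
  · intro u hu v hv
    by_cases e1 : u = w <;> by_cases e2 : v = w
    · simp [e1, e2]
    · rw [e1, hself, hval v e2]; intro _ e; have := h.room v hv (by omega); omega
    · rw [e2, hself, hval u e1]; intro _ e; have := h.room u hu (by omega); omega
    · rw [hval u e1, hval v e2]; exact h.inj u hu v hv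
  · intro u hu
    by_cases e1 : u = w
    · rw [e1, hself]; omega
    · rw [hval u e1]; exact h.le u hu
  · intro x h1 h2
    rw [hocc]
    by_cases e : x = L - 1
    · exact Or.inr e
    · exact Or.inl (h.occ x (by omega) (by omega))
  · intro u hu
    by_cases e1 : u = w
    · rw [e1, hself]; omega
    · rw [hval u e1]; intro h1; have := h.room u hu (by omega); omega
  · intro u hu v hv
    by_cases e1 : u = w <;> by_cases e2 : v = w
    · simp [e1, e2]
    · rw [e1, hself, hval v e2]; intro _ e
      have : v = lo := h.inj v hv lo h.lo_lt (by omega) (by rw [h.pos_lo]; omega)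
      rw [this]; exact ha.symm
    · rw [e2, hself, hval u e1]; intro h1 e; have := h.room u hu (by omega); omega
    · rw [hval u e1, hval v e2]; exact h.adj u hu v hv
  · intro u hu h1 h2 h3 v hv h4
    by_cases e1 : u = w
    · rw [e1, hself] at h2; omega
    · rw [hval u e1] at h1 h2
      have := h.closed u hu h1 (by omega) (hfree u e1 h3) v hv h4
      rw [hval v (hone v this)]; exact this
  · intro u hu v hv h1 h2 h3 h4 h5 x h6 h7
    rw [hocc]
    by_cases e1 : u = w
    · rw [e1, hself] at h6 h2
      have e2 : v ≠ w := fun e => h3.ne (e1.trans e.symm)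
      rw [hval v e2] at h2 h7
      have := h.le v hv
      by_cases e : x = L - 1
      · exact Or.inr e
      · exact Or.inl (h.occ x (by omega) (by omega))
    · rw [hval u e1] at h1 h2 h6
      by_cases e2 : v = w
      · rw [e2, hself] at h2
        rw [e2] at h3
        have := h.closed u hu h1 (by omega) (hfree u e1 h4) w hw h3; omega
      · rw [hval v e2] at h2 h7
        exact Or.inl (h.between u hu v hv h1 h2 h3 (hfree u e1 h4) (hfree v e2 h5) x h6 h7)

/-- The last path can be abandoned because neither end has an unplaced neighbour; this extends
`closed` to it. The distance `n + 1` provides the room for growth to the left. -/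
lemma place_new (h : PathLayout G n pos k lo hi L R) (hk : k < n) (hw : w < n) (hw0 : pos w = 0)
    (hlo : ∀ v < n, G.Adj lo v → 0 < pos v) (hhi : ∀ v < n, G.Adj hi v → 0 < pos v) :
    PathLayout G n (Function.update pos w (R + n + 1)) (k + 1) w w (R + n + 1) (R + n + 1) := by
  have hL := h.pos_of
  have hLR := h.le_hi
  have hx : 0 < R + n + 1 := by omega
  have hn : 0 < n := by omega
  have hocc := occupied_update (n := n) (pos := pos) hw hw0 hx
  have hfree := fun u => hasFreeEnd_of_update (n := n) (pos := pos) (u := u) hw hw0 hx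
  have hval : ∀ u, u ≠ w → Function.update pos w (R + n + 1) u = pos u := fun u hu =>
    Function.update_of_ne hu _ _
  have hself : Function.update pos w (R + n + 1) w = R + n + 1 := by simp
  have hone : ∀ u, 0 < pos u → u ≠ w := by rintro u hu rfl; omega
  have hclosed : ∀ u < n, 0 < pos u → HasFreeEnd n pos u → ∀ v < n, G.Adj u v → 0 < pos v := by
    intro u hu h1 h2 v hv h3
    by_cases e : pos u < L
    · exact h.closed u hu h1 e h2 v hv h3
    · rcases h.end_of_hasFreeEnd hu (by omega) h2 with rfl | rfl
      · exact hlo v hv h3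
      · exact hhi v hv h3
  refine ⟨by rw [card_placed_update hw hw0 hx, h.card], hw, hw, hself, hself, hx,
    ?_, ?_, ?_, ?_, ?_, ?_, ?_⟩
  · intro u hu v hv
    by_cases e1 : u = w <;> by_cases e2 : v = w
    · simp [e1, e2]
    · rw [e1, hself, hval v e2]; intro _ e; have := h.le v hv; omega
    · rw [e2, hself, hval u e1]; intro _ e; have := h.le u hu; omega
    · rw [hval u e1, hval v e2]; exact h.inj u hu v hv
  · intro u hu
    by_cases e1 : u = w
    · rw [e1, hself]
    · rw [hval u e1]; have := h.le u hu; omega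
  · intro x h1 h2
    rw [hocc]
    exact Or.inr (by omega)
  · intro u hu
    by_cases e1 : u = w
    · rw [e1, hself]; omega
    · rw [hval u e1]; intro h1; have := h.le u hu; omega
  · intro u hu v hv
    by_cases e1 : u = w <;> by_cases e2 : v = w
    · simp [e1, e2]
    · rw [e1, hself, hval v e2]; intro _ e; have := h.le v hv; omega
    · rw [e2, hself, hval u e1]; intro h1 e; have := h.le u hu; omega
    · rw [hval u e1, hval v e2]; exact h.adj u hu v hv
  · intro u hu h1 h2 h3 v hv h4
    by_cases e1 : u = w
    · rw [e1, hself] at h2; omega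
    · rw [hval u e1] at h1 h2
      have := hclosed u hu h1 (hfree u e1 h3) v hv h4
      rw [hval v (hone v this)]; exact this
  · intro u hu v hv h1 h2 h3 h4 h5 x h6 h7
    rw [hocc]
    by_cases e1 : u = w
    · rw [e1, hself] at h2
      have e2 : v ≠ w := fun e => h3.ne (e1.trans e.symm)
      rw [hval v e2] at h2
      have := h.le v hv; omega
    · rw [hval u e1] at h1 h2 h6
      by_cases e2 : v = w
      · rw [e2] at h3
        have := hclosed u hu h1 (hfree u e1 h4) w hw h3; omega
      · rw [hval v e2] at h2 h7
        exact Or.inl (h.between u hu v hv h1 h2 h3 (hfree u e1 h4) (hfree v e2 h5) x h6 h7)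

lemma single (G : SimpleGraph ℕ) (hn : 0 < n) :
    PathLayout G n (Function.update (fun _ => 0) 0 (n + 1)) 1 0 0 (n + 1) (n + 1) := by
  have hval : ∀ u, u ≠ 0 → Function.update (fun _ => 0) 0 (n + 1) u = 0 := fun u hu =>
    Function.update_of_ne hu _ _
  have hself : Function.update (fun _ => 0) 0 (n + 1) 0 = n + 1 := by simp
  have hone : ∀ u, 0 < Function.update (fun _ => 0) 0 (n + 1) u → u = 0 := fun u hu => by
    by_contra h; rw [hval u h] at hu; omega
  refine ⟨?_, hn, hn, hself, hself, by omega, ?_, ?_, ?_, ?_, ?_, ?_, ?_⟩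
  · rw [card_placed_update hn rfl (by omega)]; simp
  · intro u _ v _ h1 h2
    rw [hone u h1, hone v (h2 ▸ h1)]
  · intro u _
    by_cases e : u = 0
    · rw [e, hself]
    · rw [hval u e]; omega
  · intro x h1 h2
    exact ⟨by omega, 0, hn, by rw [hself]; omega⟩
  · intro u _
    by_cases e : u = 0
    · rw [e, hself]; omega
    · rw [hval u e]; omega
  · intro u _ v _ h1 h2
    rw [hone u h1, hone v (by omega), hself] at h2; omega
  · intro u _ h1 h2
    rw [hone u h1, hself] at h2; omega
  · intro u _ v _ h1 h2 h3
    exact absurd ((hone u h1).trans (hone v (by omega)).symm) h3.ne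

lemma exists_unplaced (h : PathLayout G n pos k lo hi L R) (hk : k < n) :
    ∃ w < n, pos w = 0 := by
  by_contra hc
  push Not at hc
  have : ((Finset.range n).filter fun v => 0 < pos v) = Finset.range n :=
    Finset.filter_true_of_mem fun v hv => Nat.pos_of_ne_zero (hc v (Finset.mem_range.1 hv))
  have h1 := h.card
  rw [this, Finset.card_range] at h1
  omega

lemma all_placed (h : PathLayout G n pos n lo hi L R) {u : ℕ} (hu : u < n) : 0 < pos u := by
  have h1 : ((Finset.range n).filter fun v => 0 < pos v) = Finset.range n :=
    Finset.eq_of_subset_of_card_le (Finset.filter_subset _ _) (by rw [h.card, Finset.card_range])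
  have h2 := Finset.mem_range.2 hu
  rw [← h1] at h2
  exact (Finset.mem_filter.1 h2).2

/-- Outside the paths, a vertex with a free end has at most one neighbour with a free end. -/
lemma unique_free_neighbor (h : PathLayout G n pos n lo hi L R) {u v w : ℕ} (hu : u < n)
    (hv : v < n) (hw : w < n) (hfu : HasFreeEnd n pos u) (hfv : HasFreeEnd n pos v)
    (hfw : HasFreeEnd n pos w) (huv : G.Adj u v) (huw : G.Adj u w) : v = w := by
  have pu := h.all_placed hu
  have pv := h.all_placed hv
  have pw := h.all_placed hw
  have nuv : pos u ≠ pos v := fun e => huv.ne (h.inj u hu v hv pu e)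
  have nuw : pos u ≠ pos w := fun e => huw.ne (h.inj u hu w hw pu e)
  by_contra hvw
  have nvw : pos v ≠ pos w := fun e => hvw (h.inj v hv w hw pv e)
  have key : ∀ {a b : ℕ}, a < n → b < n → HasFreeEnd n pos a → HasFreeEnd n pos b → G.Adj a b →
      pos a < pos b → ∀ x, pos a ≤ x → x ≤ pos b → Occupied n pos x :=
    fun ha hb fa fb hab hlt => h.between _ ha _ hb (h.all_placed ha) hlt hab fa fb
  -- All three vertices lie in one run of occupied positions. The middle one has both adjacent
  -- positions occupied, so it has no free end.
  rcases lt_or_gt_of_ne nuv with h1 | h1 <;> rcases lt_or_gt_of_ne nuw with h2 | h2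
  · have o1 := key hu hv hfu hfv huv h1
    have o2 := key hu hw hfu hfw huw h2
    rcases lt_or_gt_of_ne nvw with h3 | h3
    · exact hfv ⟨o1 _ (by omega) (by omega), o2 _ (by omega) (by omega)⟩
    · exact hfw ⟨o2 _ (by omega) (by omega), o1 _ (by omega) (by omega)⟩
  · have o1 := key hu hv hfu hfv huv h1
    have o2 := key hw hu hfw hfu huw.symm h2
    exact hfu ⟨o2 _ (by omega) (by omega), o1 _ (by omega) (by omega)⟩
  · have o1 := key hv hu hfv hfu huv.symm h1
    have o2 := key hu hw hfu hfw huw h2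
    exact hfu ⟨o1 _ (by omega) (by omega), o2 _ (by omega) (by omega)⟩
  · have o1 := key hv hu hfv hfu huv.symm h1
    have o2 := key hw hu hfw hfu huw.symm h2
    rcases lt_or_gt_of_ne nvw with h3 | h3
    · exact hfw ⟨o1 _ (by omega) (by omega), o2 _ (by omega) (by omega)⟩
    · exact hfv ⟨o2 _ (by omega) (by omega), o1 _ (by omega) (by omega)⟩

end PathLayout

/-! ### Attaching the points for the edges outside the paths -/

/-- The segments of `u` and `v` share an end. -/
def Consecutive (pos : ℕ → ℕ) (u v : ℕ) : Prop :=
  pos u + 1 = pos v ∨ pos v + 1 = pos u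

/-- The segment from `pos v` to `pos v + 1` or the point `pt v` of the vertex `v` touches `x`. -/
def Touches (pos pt : ℕ → ℕ) (v x : ℕ) : Prop :=
  pos v = x ∨ pos v + 1 = x ∨ pt v = x

/-- Both ends of the segment of `v` are used. -/
def EndsUsed (pos occ : ℕ → ℕ) (v : ℕ) : Prop :=
  2 ≤ occ (pos v) ∧ 2 ≤ occ (pos v + 1)

/-- The place where the point of a further neighbour is attached to `v`. -/
def slot (pos pt occ : ℕ → ℕ) (v : ℕ) : ℕ :=
  if occ (pos v) < 2 then pos v else if occ (pos v + 1) < 2 then pos v + 1 else pt v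

/-- The segments and points represent the edges in `P`, a part of the edges of `G`; `occ` counts
the vertices at the ends of the segments. -/
structure Attached (G : SimpleGraph ℕ) (n : ℕ) (pos pt occ : ℕ → ℕ) (P : ℕ → ℕ → Prop) :
    Prop where
  sub : ∀ u v, P u v → G.Adj u v
  symm : ∀ u v, P u v → P v u
  meet : ∀ u < n, ∀ v < n, u ≠ v → ((∃ x, Touches pos pt u x ∧ Touches pos pt v x) ↔ P u v)
  -- Two vertices have at most one common point, so different places touched on a vertex belong to
  -- different neighbours.
  uniq : ∀ u < n, ∀ v < n, u ≠ v → ∀ x y, Touches pos pt u x → Touches pos pt v x →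
    Touches pos pt u y → Touches pos pt v y → x = y
  proper : ∀ u < n, pt u ≠ pos u ∧ pt u ≠ pos u + 1
  occ_le : ∀ x, occ x ≤ 2
  -- The vertex `v` itself counts once, so the value 2 signals another vertex.
  occ_iff : ∀ v < n, ∀ x, (x = pos v ∨ x = pos v + 1) →
    (2 ≤ occ x ↔ ∃ w < n, w ≠ v ∧ Touches pos pt w x)
  -- A point in contact with another vertex is accounted for in one of two ways: the ends of the
  -- segment are used, or the edge to an adjacent path end is already represented.
  spent : ∀ u < n, ∀ w < n, w ≠ u → Touches pos pt w (pt u) → EndsUsed pos occ u ∨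
    ∃ w < n, P u w ∧ ¬ Consecutive pos u w ∧ HasFreeEnd n pos u ∧ HasFreeEnd n pos w

namespace Attached

variable {G : SimpleGraph ℕ} {n : ℕ} {pos pt occ : ℕ → ℕ} {P : ℕ → ℕ → Prop} {lo hi L R : ℕ}

lemma congr {Q : ℕ → ℕ → Prop} (h : Attached G n pos pt occ P) (e : ∀ u v, P u v ↔ Q u v) :
    Attached G n pos pt occ Q := by
  have : P = Q := by funext u v; exact propext (e u v)
  exact this ▸ h

/-- If the ends of `u` are used and some edge at `u` is missing, then the point of `u` is free. -/
lemma point_free (h : Attached G n pos pt occ P)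
    (hdeg : ∀ u a b c d, G.Adj u a → G.Adj u b → G.Adj u c → G.Adj u d →
      a ≠ b → a ≠ c → a ≠ d → b ≠ c → b ≠ d → c ≠ d → False)
    {u v : ℕ} (hu : u < n) (huv : G.Adj u v) (hP : ¬ P u v)
    (hf : EndsUsed pos occ u) : ∀ w < n, w ≠ u → ¬ Touches pos pt w (pt u) := by
  intro w hw hwu ht
  obtain ⟨a, ha, hau, hta⟩ := (h.occ_iff u hu _ (Or.inl rfl)).1 hf.1
  obtain ⟨b, hb, hbu, htb⟩ := (h.occ_iff u hu _ (Or.inr rfl)).1 hf.2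
  have t1 : Touches pos pt u (pos u) := Or.inl rfl
  have t2 : Touches pos pt u (pos u + 1) := Or.inr (Or.inl rfl)
  have t3 : Touches pos pt u (pt u) := Or.inr (Or.inr rfl)
  have pa := (h.meet u hu a ha hau.symm).1 ⟨_, t1, hta⟩
  have pb := (h.meet u hu b hb hbu.symm).1 ⟨_, t2, htb⟩
  have pw := (h.meet u hu w hw hwu.symm).1 ⟨_, t3, ht⟩
  have hp := h.proper u hu
  -- The vertices `a`, `b`, `w`, `v` would be four neighbours of `u`. The first three differ by
  -- `uniq`, as they touch `u` at different places; `v` differs from them since its edge is missing.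
  refine hdeg u a b w v (h.sub _ _ pa) (h.sub _ _ pb) (h.sub _ _ pw) huv ?_ ?_ ?_ ?_ ?_ ?_
  · rintro rfl
    have := h.uniq u hu a ha hau.symm _ _ t1 hta t2 htb; omega
  · rintro rfl
    exact hp.1 (h.uniq u hu a ha hau.symm _ _ t1 hta t3 ht).symm
  · rintro rfl; exact hP pa
  · rintro rfl
    exact hp.2 (h.uniq u hu b hb hbu.symm _ _ t2 htb t3 ht).symm
  · rintro rfl; exact hP pb
  · rintro rfl; exact hP pw

/-- Vertices at both adjacent positions would touch both ends of the segment. The converse fails,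
because an end may also be used by an attached point. -/
lemma hasFreeEnd (h : Attached G n pos pt occ P) {v : ℕ} (hv : v < n)
    (hf : ¬ EndsUsed pos occ v) : HasFreeEnd n pos v := by
  rintro ⟨⟨h1, a, ha, ea⟩, ⟨h2, b, hb, eb⟩⟩
  refine hf ⟨(h.occ_iff v hv _ (Or.inl rfl)).2 ⟨a, ha, ?_, ?_⟩,
    (h.occ_iff v hv _ (Or.inr rfl)).2 ⟨b, hb, ?_, Or.inl eb⟩⟩
  · rintro rfl; omega
  · exact Or.inr (Or.inl (by omega))
  · rintro rfl; omega

/-- A segment end with count below 2 is untouched by others. The slot is the point of `v` only when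
both ends are used, and then the missing edge makes `point_free` applicable. -/
lemma slot_spec (h : Attached G n pos pt occ P)
    (hdeg : ∀ u a b c d, G.Adj u a → G.Adj u b → G.Adj u c → G.Adj u d →
      a ≠ b → a ≠ c → a ≠ d → b ≠ c → b ≠ d → c ≠ d → False)
    {u v : ℕ} (hv : v < n) (huv : G.Adj u v) (hP : ¬ P u v) :
    Touches pos pt v (slot pos pt occ v) ∧
      (∀ w < n, w ≠ v → ¬ Touches pos pt w (slot pos pt occ v)) ∧
      (slot pos pt occ v = pt v → EndsUsed pos occ v) := by
  have hp := h.proper v hv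
  unfold slot
  split_ifs with h1 h2
  · refine ⟨Or.inl rfl, fun w hw hwv ht => ?_, fun e => absurd e.symm hp.1⟩
    have := (h.occ_iff v hv _ (Or.inl rfl)).2 ⟨w, hw, hwv, ht⟩; omega
  · refine ⟨Or.inr (Or.inl rfl), fun w hw hwv ht => ?_, fun e => absurd e.symm hp.2⟩
    have := (h.occ_iff v hv _ (Or.inr rfl)).2 ⟨w, hw, hwv, ht⟩; omega
  · have hf : EndsUsed pos occ v := ⟨by omega, by omega⟩
    exact ⟨Or.inr (Or.inr rfl), h.point_free hdeg hv huv.symm (fun c => hP (h.symm _ _ c)) hf,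
      fun _ => hf⟩

/-- Moving the point of `u` to the slot of `v` adds the edge between `u` and `v`. -/
lemma attach (h : Attached G n pos pt occ P) (hl : PathLayout G n pos n lo hi L R)
    (hdeg : ∀ u a b c d, G.Adj u a → G.Adj u b → G.Adj u c → G.Adj u d →
      a ≠ b → a ≠ c → a ≠ d → b ≠ c → b ≠ d → c ≠ d → False)
    {u v : ℕ} (hu : u < n) (hv : v < n) (huv : G.Adj u v) (hP : ¬ P u v)
    (hcons : ¬ Consecutive pos u v) (hf : EndsUsed pos occ u ∨ ¬ EndsUsed pos occ v) :
    Attached G n pos (Function.update pt u (slot pos pt occ v))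
      (Function.update occ (slot pos pt occ v) 2)
      (fun a b => P a b ∨ (a = u ∧ b = v) ∨ (a = v ∧ b = u)) := by
  obtain ⟨hx1, hx2, hx3⟩ := h.slot_spec hdeg hv huv hP
  generalize slot pos pt occ v = x at hx1 hx2 hx3
  have hne := huv.ne
  -- No other vertex touches the old point of `u`, so moving it destroys no edge. If `u` has an
  -- unused end, so has `v`; a spent point would provide a second neighbour of `u` with a free end,
  -- distinct from `v` because `uv` is not yet represented.
  have hfree : ∀ w < n, w ≠ u → ¬ Touches pos pt w (pt u) := by
    by_cases hfu : EndsUsed pos occ u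
    · exact h.point_free hdeg hu huv hP hfu
    · have hfv := hf.resolve_left hfu
      intro w hw hwu ht
      rcases h.spent u hu w hw hwu ht with h1 | ⟨w', hw', h1, h2, h3, h4⟩
      · exact hfu h1
      · have := hl.unique_free_neighbor hu hv hw' h3 (h.hasFreeEnd hv hfv) h4 huv (h.sub _ _ h1)
        exact hP (this ▸ h1)
  have hux : ¬ Touches pos pt u x := hx2 u hu hne
  have hmeet : ∀ y, Touches pos pt u y → ¬ Touches pos pt v y :=
    fun y h1 h2 => hP ((h.meet u hu v hv hne).1 ⟨y, h1, h2⟩)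
  have hself : Function.update pt u x u = x := by simp
  have hval : ∀ w, w ≠ u → Function.update pt u x w = pt w := fun w hw =>
    Function.update_of_ne hw _ _
  have tne : ∀ w, w ≠ u → ∀ y, Touches pos (Function.update pt u x) w y ↔ Touches pos pt w y :=
    fun w hw y => by unfold Touches; rw [hval w hw]
  have hpu := h.proper u hu
  have tu : ∀ y, Touches pos (Function.update pt u x) u y ↔
      (Touches pos pt u y ∧ y ≠ pt u) ∨ y = x := by
    intro y
    unfold Touches
    rw [hself]
    constructor
    · rintro (e | e | e)
      · exact Or.inl ⟨Or.inl e, fun e' => hpu.1 (e'.symm.trans e.symm)⟩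
      · exact Or.inl ⟨Or.inr (Or.inl e), fun e' => hpu.2 (e'.symm.trans e.symm)⟩
      · exact Or.inr e.symm
    · rintro (⟨e | e | e, h1⟩ | e)
      · exact Or.inl e
      · exact Or.inr (Or.inl e)
      · exact absurd e.symm h1
      · exact Or.inr (Or.inr e.symm)
  have only : ∀ w < n, Touches pos pt w x → w = v := fun w hw ht => by
    by_contra hc; exact hx2 w hw hc ht
  have meet_u : ∀ w < n, w ≠ u → ∀ y, Touches pos (Function.update pt u x) u y →
      Touches pos (Function.update pt u x) w y →
      (Touches pos pt u y ∧ Touches pos pt w y) ∨ (y = x ∧ w = v) := by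
    intro w hw hwu y h1 h2
    rw [tne w hwu] at h2
    rcases (tu y).1 h1 with ⟨h3, _⟩ | rfl
    · exact Or.inl ⟨h3, h2⟩
    · exact Or.inr ⟨rfl, only w hw h2⟩
  have meet_u_iff : ∀ w < n, w ≠ u → ((∃ y, Touches pos (Function.update pt u x) u y ∧
      Touches pos (Function.update pt u x) w y) ↔ P u w ∨ w = v) := by
    intro w hw hwu
    rw [← h.meet u hu w hw hwu.symm]
    constructor
    · rintro ⟨y, h1, h2⟩
      rcases meet_u w hw hwu y h1 h2 with h3 | h3
      · exact Or.inl ⟨y, h3⟩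
      · exact Or.inr h3.2
    · rintro (⟨y, h1, h2⟩ | rfl)
      · refine ⟨y, (tu y).2 (Or.inl ⟨h1, ?_⟩), (tne w hwu y).2 h2⟩
        rintro rfl
        exact hfree w hw hwu h2
      · exact ⟨x, (tu x).2 (Or.inr rfl), (tne w hwu x).2 hx1⟩
  have uniq_u : ∀ w < n, w ≠ u → ∀ y z, Touches pos (Function.update pt u x) u y →
      Touches pos (Function.update pt u x) w y → Touches pos (Function.update pt u x) u z →
      Touches pos (Function.update pt u x) w z → y = z := by
    intro w hw hwu y z h1 h2 h3 h4
    -- An old contact cannot coexist with the new one: the new contact is with `v`, which did not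
    -- meet `u` before.
    rcases meet_u w hw hwu y h1 h2 with ⟨a1, a2⟩ | ⟨a1, a2⟩ <;>
      rcases meet_u w hw hwu z h3 h4 with ⟨b1, b2⟩ | ⟨b1, b2⟩
    · exact h.uniq u hu w hw hwu.symm _ _ a1 a2 b1 b2
    · subst b2; exact absurd a2 (hmeet _ a1)
    · subst a2; exact absurd b2 (hmeet _ b1)
    · rw [a1, b1]
  have mono : ∀ y, occ y ≤ Function.update occ x 2 y := by
    intro y
    by_cases e : y = x
    · subst e; simpa using h.occ_le y
    · rw [Function.update_of_ne e]
  have monoE : ∀ w, EndsUsed pos occ w → EndsUsed pos (Function.update occ x 2) w :=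
    fun w hw => ⟨hw.1.trans (mono _), hw.2.trans (mono _)⟩
  refine ⟨?_, ?_, ?_, ?_, ?_, ?_, ?_, ?_⟩
  · rintro a b (h1 | ⟨rfl, rfl⟩ | ⟨rfl, rfl⟩)
    · exact h.sub _ _ h1
    · exact huv
    · exact huv.symm
  · rintro a b (h1 | h1 | h1)
    · exact Or.inl (h.symm _ _ h1)
    · exact Or.inr (Or.inr ⟨h1.2, h1.1⟩)
    · exact Or.inr (Or.inl ⟨h1.2, h1.1⟩)
  · intro a ha b hb hab
    by_cases e1 : a = u
    · subst e1
      rw [meet_u_iff b hb hab.symm]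
      constructor
      · rintro (h1 | h1)
        · exact Or.inl h1
        · exact Or.inr (Or.inl ⟨rfl, h1⟩)
      · rintro (h1 | h1 | h1)
        · exact Or.inl h1
        · exact Or.inr h1.2
        · exact absurd h1.1 hne
    · by_cases e2 : b = u
      · subst e2
        refine (exists_congr fun y => and_comm).trans ((meet_u_iff a ha hab).trans ?_)
        constructor
        · rintro (h1 | h1)
          · exact Or.inl (h.symm _ _ h1)
          · exact Or.inr (Or.inr ⟨h1, rfl⟩)
        · rintro (h1 | h1 | h1)
          · exact Or.inl (h.symm _ _ h1)
          · exact absurd h1.1 e1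
          · exact Or.inr h1.1
      · simp only [tne a e1, tne b e2]
        rw [h.meet a ha b hb hab]
        simp [e1, e2]
  · intro a ha b hb hab y z h1 h2 h3 h4
    by_cases e1 : a = u
    · subst e1; exact uniq_u b hb hab.symm y z h1 h2 h3 h4
    · by_cases e2 : b = u
      · subst e2; exact uniq_u a ha hab y z h2 h1 h4 h3
      · rw [tne a e1] at h1 h3
        rw [tne b e2] at h2 h4
        exact h.uniq a ha b hb hab y z h1 h2 h3 h4
  · intro a ha
    by_cases e1 : a = u
    · subst e1
      rw [hself]
      exact ⟨fun e => hux (Or.inl e.symm), fun e => hux (Or.inr (Or.inl e.symm))⟩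
    · rw [hval a e1]; exact h.proper a ha
  · intro y
    by_cases e : y = x
    · subst e; simp
    · rw [Function.update_of_ne e]; exact h.occ_le y
  · intro a ha y hy
    by_cases e : y = x
    · subst e
      have hau : a ≠ u := by
        rintro rfl
        rcases hy with hy | hy
        · exact hux (Or.inl hy.symm)
        · exact hux (Or.inr (Or.inl hy.symm))
      simp only [Function.update_self, le_refl, true_iff]
      exact ⟨u, hu, hau.symm, (tu y).2 (Or.inr rfl)⟩
    · rw [Function.update_of_ne e, h.occ_iff a ha y hy]
      constructor
      · rintro ⟨w, hw, hwa, ht⟩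
        refine ⟨w, hw, hwa, ?_⟩
        by_cases e1 : w = u
        · subst e1
          refine (tu y).2 (Or.inl ⟨ht, ?_⟩)
          rintro rfl
          refine hfree a ha hwa.symm ?_
          rcases hy with hy | hy
          · exact Or.inl hy.symm
          · exact Or.inr (Or.inl hy.symm)
        · exact (tne w e1 y).2 ht
      · rintro ⟨w, hw, hwa, ht⟩
        refine ⟨w, hw, hwa, ?_⟩
        by_cases e1 : w = u
        · subst e1
          rcases (tu y).1 ht with h1 | h1
          · exact h1.1
          · exact absurd h1 e
        · exact (tne w e1 y).1 ht
  · intro a ha w hw hwa ht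
    by_cases e1 : a = u
    · subst e1
      rcases hf with hf | hf
      · exact Or.inl (monoE _ hf)
      -- If neither `u` nor `v` has both ends used, `v` itself becomes the witness that the point is
      -- spent.
      · by_cases hfu : EndsUsed pos occ a
        · exact Or.inl (monoE _ hfu)
        · exact Or.inr ⟨v, hv, Or.inr (Or.inl ⟨rfl, rfl⟩), hcons, h.hasFreeEnd ha hfu,
            h.hasFreeEnd hv hf⟩
    · rw [hval a e1] at ht
      have old : ∀ w < n, w ≠ a → Touches pos pt w (pt a) →
          EndsUsed pos (Function.update occ x 2) a ∨
          ∃ w < n, (P a w ∨ (a = u ∧ w = v) ∨ (a = v ∧ w = u)) ∧ ¬ Consecutive pos a w ∧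
            HasFreeEnd n pos a ∧ HasFreeEnd n pos w := by
        intro w hw hwa ht
        rcases h.spent a ha w hw hwa ht with h1 | ⟨b, hb, h1, h2⟩
        · exact Or.inl (monoE _ h1)
        · exact Or.inr ⟨b, hb, Or.inl h1, h2⟩
      by_cases e2 : w = u
      · rw [e2] at ht
        rcases (tu _).1 ht with h1 | h1
        · exact old u hu (Ne.symm e1) h1.1
        -- The moved point landed on the point of `v`; that happens only when both ends of `v` are
        -- used.
        · have : a = v := only a ha (Or.inr (Or.inr h1))
          subst this
          exact Or.inl (monoE _ (hx3 h1.symm))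
      · exact old w hw hwa ((tne w e2 _).1 ht)

/-- Before any point is attached, exactly the edges between consecutive vertices are
represented. -/
lemma initial (hl : PathLayout G n pos n lo hi L R) (hpt : ∀ v < n, pt v = R + 2 + v) :
    Attached G n pos pt
      (fun x => ∑ v ∈ Finset.range n,
        ((if pos v = x then 1 else 0) + (if pos v + 1 = x then 1 else 0)))
      (fun u v => G.Adj u v ∧ Consecutive pos u v) := by
  have hinj : ∀ u < n, ∀ v < n, pos u = pos v → u = v := fun u hu v hv e =>
    hl.inj u hu v hv (hl.all_placed hu) e
  have hR := hl.le
  have hocc : ∀ x, (∑ v ∈ Finset.range n,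
      ((if pos v = x then 1 else 0) + (if pos v + 1 = x then 1 else 0))) =
      ((Finset.range n).filter fun v => pos v = x).card +
        ((Finset.range n).filter fun v => pos v + 1 = x).card := by
    intro x
    rw [Finset.sum_add_distrib, Finset.card_filter, Finset.card_filter]
  have h1 : ∀ x, ((Finset.range n).filter fun v => pos v = x).card ≤ 1 := by
    intro x
    rw [Finset.card_le_one]
    intro a ha b hb
    simp only [Finset.mem_filter, Finset.mem_range] at ha hb
    exact hinj a ha.1 b hb.1 (by omega)
  have h2 : ∀ x, ((Finset.range n).filter fun v => pos v + 1 = x).card ≤ 1 := by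
    intro x
    rw [Finset.card_le_one]
    intro a ha b hb
    simp only [Finset.mem_filter, Finset.mem_range] at ha hb
    exact hinj a ha.1 b hb.1 (by omega)
  have p1 : ∀ x, 0 < ((Finset.range n).filter fun v => pos v = x).card ↔
      ∃ w < n, pos w = x := by
    intro x; rw [Finset.card_pos]; simp [Finset.Nonempty]
  have p2 : ∀ x, 0 < ((Finset.range n).filter fun v => pos v + 1 = x).card ↔
      ∃ w < n, pos w + 1 = x := by
    intro x; rw [Finset.card_pos]; simp [Finset.Nonempty]
  -- The initial points are distinct and lie beyond `R + 1`, the largest end of a segment. So the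
  -- only contacts are shared ends of consecutive segments.
  have hT : ∀ u < n, ∀ v < n, u ≠ v → ∀ x, Touches pos pt u x →
      Touches pos pt v x →
      (pos u + 1 = pos v ∧ x = pos v) ∨ (pos v + 1 = pos u ∧ x = pos u) := by
    intro u hu v hv huv x a b
    have := hR u hu
    have := hR v hv
    have := hpt u hu
    have := hpt v hv
    have : pos u ≠ pos v := fun e => huv (hinj u hu v hv e)
    unfold Touches at a b
    omega
  refine ⟨fun u v h => h.1, fun u v h => ⟨h.1.symm, h.2.symm⟩, ?_, ?_, ?_, ?_, ?_, ?_⟩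
  · intro u hu v hv huv
    constructor
    · rintro ⟨x, a, b⟩
      rcases hT u hu v hv huv x a b with h | h
      · exact ⟨hl.adj u hu v hv (hl.all_placed hu) h.1.symm, Or.inl h.1⟩
      · exact ⟨(hl.adj v hv u hu (hl.all_placed hv) h.1.symm).symm, Or.inr h.1⟩
    · rintro ⟨_, h | h⟩
      · exact ⟨_, Or.inr (Or.inl h), Or.inl rfl⟩
      · exact ⟨_, Or.inl rfl, Or.inr (Or.inl h)⟩
  · intro u hu v hv huv x y a b c d
    have := hT u hu v hv huv x a b
    have := hT u hu v hv huv y c d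
    omega
  · intro u hu
    have := hR u hu
    have := hpt u hu
    omega
  · intro x
    rw [hocc]
    have := h1 x
    have := h2 x
    omega
  · intro v hv x hx
    rw [hocc]
    have c1 := h1 x
    have c2 := h2 x
    rcases hx with rfl | rfl
    · have c3 := (p1 (pos v)).2 ⟨v, hv, rfl⟩
      rw [show (2 ≤ ((Finset.range n).filter fun w => pos w = pos v).card +
        ((Finset.range n).filter fun w => pos w + 1 = pos v).card) ↔
        0 < ((Finset.range n).filter fun w => pos w + 1 = pos v).card by omega, p2]
      constructor
      · rintro ⟨w, hw, e⟩
        exact ⟨w, hw, by rintro rfl; omega, Or.inr (Or.inl e)⟩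
      · rintro ⟨w, hw, hwv, ht⟩
        have := hT w hw v hv hwv _ ht (Or.inl rfl)
        exact ⟨w, hw, by omega⟩
    · have c3 := (p2 (pos v + 1)).2 ⟨v, hv, rfl⟩
      rw [show (2 ≤ ((Finset.range n).filter fun w => pos w = pos v + 1).card +
        ((Finset.range n).filter fun w => pos w + 1 = pos v + 1).card) ↔
        0 < ((Finset.range n).filter fun w => pos w = pos v + 1).card by omega, p1]
      constructor
      · rintro ⟨w, hw, e⟩
        exact ⟨w, hw, by rintro rfl; omega, Or.inl e⟩
      · rintro ⟨w, hw, hwv, ht⟩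
        have := hT w hw v hv hwv _ ht (Or.inr (Or.inl rfl))
        exact ⟨w, hw, by omega⟩
  · intro u hu w hw hwu ht
    have := hT w hw u hu hwu _ ht (Or.inr (Or.inr rfl))
    have := hR u hu
    have := hR w hw
    have := hpt u hu
    omega

end Attached

/-! ### From integer positions to real intervals -/

/-- The interval `[p, p + 1]`. -/
noncomputable def unitSegment (p : ℕ) : NonemptyInterval ℝ :=
  ⟨((p : ℝ), ((p + 1 : ℕ) : ℝ)), by push_cast; linarith⟩

/-- The interval `[x, x]`. -/
noncomputable def pointInterval (x : ℕ) : NonemptyInterval ℝ :=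
  ⟨((x : ℝ), (x : ℝ)), le_rfl⟩

/-- Each vertex gets its segment and its point. -/
noncomputable def segmentAndPoint {n : ℕ} (pos pt : ℕ → ℕ) (u : Fin n) :
    Set (NonemptyInterval ℝ) :=
  {unitSegment (pos u), pointInterval (pt u)}

lemma natCast_mem_of_touches {n : ℕ} {pos pt : ℕ → ℕ} {u : Fin n} {x : ℕ}
    (h : Touches pos pt u x) :
    ∃ I ∈ segmentAndPoint pos pt u, (x : ℝ) ∈ Set.Icc I.fst I.snd := by
  rcases h with rfl | rfl | rfl
  · exact ⟨_, Or.inl rfl, by simp [unitSegment]⟩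
  · exact ⟨_, Or.inl rfl, by simp [unitSegment]⟩
  · exact ⟨_, Or.inr rfl, by simp [pointInterval]⟩

lemma mem_unitSegment {p : ℕ} {y : ℝ} :
    y ∈ Set.Icc (unitSegment p).fst (unitSegment p).snd ↔ (p : ℝ) ≤ y ∧ y ≤ (p + 1 : ℕ) := Iff.rfl

lemma mem_pointInterval {x : ℕ} {y : ℝ} :
    y ∈ Set.Icc (pointInterval x).fst (pointInterval x).snd ↔ (x : ℝ) ≤ y ∧ y ≤ x := Iff.rfl

/-- Segments of unit length and points with integer ends can only meet in a set containing an
integer end. The hypothesis excludes equal segments, although a common end would exist there too. -/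
lemma familiesMeet_segmentAndPoint {n : ℕ} {pos pt : ℕ → ℕ} {u v : Fin n}
    (huv : pos u ≠ pos v) :
    FamiliesMeet (segmentAndPoint pos pt u) (segmentAndPoint pos pt v) ↔
      ∃ x, Touches pos pt u x ∧ Touches pos pt v x := by
  constructor
  · rintro ⟨I, hI, J, hJ, y, hyI, hyJ⟩
    rcases hI with rfl | rfl <;> rcases hJ with rfl | rfl
    · rw [mem_unitSegment] at hyI hyJ
      have h1 : pos u ≤ pos v + 1 := by exact_mod_cast hyI.1.trans hyJ.2
      have h2 : pos v ≤ pos u + 1 := by exact_mod_cast hyJ.1.trans hyI.2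
      by_cases h : pos u + 1 = pos v
      · exact ⟨_, Or.inr (Or.inl h), Or.inl rfl⟩
      · exact ⟨pos u, Or.inl rfl, Or.inr (Or.inl (by omega))⟩
    · rw [mem_unitSegment] at hyI
      rw [mem_pointInterval] at hyJ
      have h1 : pos u ≤ pt v := by exact_mod_cast hyI.1.trans hyJ.2
      have h2 : pt v ≤ pos u + 1 := by exact_mod_cast hyJ.1.trans hyI.2
      refine ⟨pt v, ?_, Or.inr (Or.inr rfl)⟩
      unfold Touches
      omega
    · rw [mem_unitSegment] at hyJ
      rw [mem_pointInterval] at hyI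
      have h1 : pos v ≤ pt u := by exact_mod_cast hyJ.1.trans hyI.2
      have h2 : pt u ≤ pos v + 1 := by exact_mod_cast hyI.1.trans hyJ.2
      refine ⟨pt u, Or.inr (Or.inr rfl), ?_⟩
      unfold Touches
      omega
    · rw [mem_pointInterval] at hyI hyJ
      have h1 : pt u ≤ pt v := by exact_mod_cast hyI.1.trans hyJ.2
      have h2 : pt v ≤ pt u := by exact_mod_cast hyJ.1.trans hyI.2
      exact ⟨pt u, Or.inr (Or.inr rfl), Or.inr (Or.inr (by omega))⟩
  · rintro ⟨x, h1, h2⟩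
    obtain ⟨I, hI, hx⟩ := natCast_mem_of_touches h1
    obtain ⟨J, hJ, hy⟩ := natCast_mem_of_touches h2
    exact ⟨I, hI, J, hJ, x, hx, hy⟩

/-- No natural number lies strictly between `p` and `p + 1`. -/
lemma noForeignEndpointInside_unitSegment {n : ℕ} {pos pt : ℕ → ℕ} {u : Fin n} :
    NoForeignEndpointInside (segmentAndPoint (n := n) pos pt) u (unitSegment (pos u)) := by
  have key : ∀ m : ℕ, (m : ℝ) ∉ Set.Ioo (unitSegment (pos u)).fst (unitSegment (pos u)).snd := by
    rintro m ⟨h1, h2⟩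
    have h1 : pos u < m := Nat.cast_lt.1 h1
    have h2 : m < pos u + 1 := Nat.cast_lt.1 h2
    omega
  rintro v - J (rfl | rfl)
  · exact ⟨key (pos v + 1), key (pos v)⟩
  · exact ⟨key (pt v), key (pt v)⟩

lemma isSpecialRepresentation_segmentAndPoint {n : ℕ} {G : SimpleGraph (Fin n)} {pos pt : ℕ → ℕ}
    (hinj : ∀ u v : Fin n, pos u = pos v → u = v)
    (hproper : ∀ u : Fin n, pt u ≠ pos u ∧ pt u ≠ pos u + 1)
    (hmeet : ∀ u v : Fin n, u ≠ v →
      ((∃ x, Touches pos pt u x ∧ Touches pos pt v x) ↔ G.Adj u v)) :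
    IsSpecialRepresentation G (segmentAndPoint (n := n) pos pt) := by
  refine ⟨⟨fun u => ?_, ?_, ?_⟩, ?_⟩
  · exact (Set.encard_insert_le _ _).trans (by rw [Set.encard_singleton]; norm_num)
  · intro u v huv
    have h1 : unitSegment (pos u) ∈ segmentAndPoint pos pt v := by
      rw [← huv]; exact Or.inl rfl
    rcases h1 with h1 | h1
    · exact hinj u v (Nat.cast_injective (congrArg (fun I : NonemptyInterval ℝ => I.fst) h1))
    · have h2 : pos u = pt v :=
        Nat.cast_injective (congrArg (fun I : NonemptyInterval ℝ => I.fst) h1)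
      have h3 : pos u + 1 = pt v :=
        Nat.cast_injective (congrArg (fun I : NonemptyInterval ℝ => I.snd) h1)
      omega
  · intro u v huv
    rw [familiesMeet_segmentAndPoint fun e => huv (hinj u v e), hmeet u v huv]
  · intro u
    have h := hproper u
    rcases lt_or_ge (pt u) (pos u) with h1 | h1
    · refine ⟨pointInterval (pt u), unitSegment (pos u), Set.pair_comm _ _, Or.inl
        ⟨rfl, ?_, ?_, noForeignEndpointInside_unitSegment⟩⟩
      · exact Nat.cast_lt.2 h1
      · exact Nat.cast_lt.2 (Nat.lt_succ_self _)
    · refine ⟨unitSegment (pos u), pointInterval (pt u), rfl, Or.inr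
        ⟨?_, ?_, rfl, noForeignEndpointInside_unitSegment⟩⟩
      · exact Nat.cast_lt.2 (Nat.lt_succ_self _)
      · exact Nat.cast_lt.2 (by omega)

/-! ### Reasoning about programs and their running time -/

namespace RAM

/-- Started in `s`, the program halts after at most `T` steps, in a state satisfying `Q`. -/
def Halts (p : Program) (s : State) (T : ℕ) (Q : State → Prop) : Prop :=
  ∃ t s', Runs p s t s' ∧ t ≤ T ∧ Q s'

lemma Halts.mono {p : Program} {s : State} {T T' : ℕ} {Q Q' : State → Prop}
    (h : Halts p s T Q) (hT : T ≤ T') (hQ : ∀ s', Q s' → Q' s') : Halts p s T' Q' := by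
  obtain ⟨t, s', h1, h2, h3⟩ := h
  exact ⟨t, s', h1, h2.trans hT, hQ _ h3⟩

lemma Halts.seq {p q : Program} {s : State} {T₁ T₂ : ℕ} {M Q : State → Prop}
    (h : Halts p s T₁ M) (hq : ∀ s', M s' → Halts q s' T₂ Q) :
    Halts (.seq p q) s (T₁ + T₂) Q := by
  obtain ⟨t, s', h1, h2, h3⟩ := h
  obtain ⟨t', s'', h4, h5, h6⟩ := hq s' h3
  exact ⟨t + t', s'', .seq h1 h4, by omega, h6⟩

/-- The program has no loops. -/
def Program.LoopFree : Program → Prop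
  | .seq p q => p.LoopFree ∧ q.LoopFree
  | .ifLt _ _ p q => p.LoopFree ∧ q.LoopFree
  | .whileLt _ _ _ => False
  | _ => True

/-- A bound for the number of steps of a program without loops. -/
def Program.cost : Program → ℕ
  | .seq p q => p.cost + q.cost
  | .ifLt _ _ p q => 1 + max p.cost q.cost
  | _ => 1

/-- The effect of a program without loops. -/
def Program.exec : Program → State → State
  | .skip, s => s
  | .const x k, s => s.setReg x k
  | .add x y z, s => s.setReg x (s.reg y + s.reg z)
  | .sub x y z, s => s.setReg x (s.reg y - s.reg z)
  | .load x a y, s => s.setReg x (s.arr a (s.reg y))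
  | .store a x y, s => s.setArr a (s.reg x) (s.reg y)
  | .seq p q, s => q.exec (p.exec s)
  | .ifLt x y p q, s => if s.reg x < s.reg y then p.exec s else q.exec s
  | .whileLt _ _ _, s => s

lemma Program.LoopFree.runs {p : Program} (hp : p.LoopFree) (s : State) :
    ∃ t, Runs p s t (p.exec s) ∧ t ≤ p.cost := by
  induction p generalizing s with
  | skip => exact ⟨1, .skip s, le_rfl⟩
  | const x k => exact ⟨1, .const s x k, le_rfl⟩
  | add x y z => exact ⟨1, .add s x y z, le_rfl⟩
  | sub x y z => exact ⟨1, .sub s x y z, le_rfl⟩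
  | load x a y => exact ⟨1, .load s x a y, le_rfl⟩
  | store a x y => exact ⟨1, .store s a x y, le_rfl⟩
  | seq p q ihp ihq =>
    obtain ⟨t, h1, h2⟩ := ihp hp.1 s
    obtain ⟨t', h3, h4⟩ := ihq hp.2 (p.exec s)
    exact ⟨t + t', .seq h1 h3, Nat.add_le_add h2 h4⟩
  | ifLt x y p q ihp ihq =>
    by_cases h : s.reg x < s.reg y
    · obtain ⟨t, h1, h2⟩ := ihp hp.1 s
      refine ⟨1 + t, ?_, Nat.add_le_add le_rfl (h2.trans (le_max_left _ _))⟩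
      simp only [Program.exec, if_pos h]
      exact .ifTrue h h1
    · obtain ⟨t, h1, h2⟩ := ihq hp.2 s
      refine ⟨1 + t, ?_, Nat.add_le_add le_rfl (h2.trans (le_max_right _ _))⟩
      simp only [Program.exec, if_neg h]
      exact .ifFalse h h1
  | whileLt x y p => exact hp.elim

lemma Program.LoopFree.halts {p : Program} (hp : p.LoopFree) {s : State} {T : ℕ}
    {Q : State → Prop} (hT : p.cost ≤ T) (hQ : Q (p.exec s)) : Halts p s T Q := by
  obtain ⟨t, h1, h2⟩ := hp.runs s
  exact ⟨t, _, h1, h2.trans hT, hQ⟩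

/-- Repeat `p`, adding register `1` to register `x` after each round, while `x < y`. -/
def countUp (x y : ℕ) (p : Program) : Program :=
  .whileLt x y (.seq p (.add x x 1))

/-- Induction on the number of remaining rounds. Besides the body, a round costs one step for the
test and one for the increment; the last failing test costs one more. -/
lemma halts_countUp {x y : ℕ} {p : Program} {N T : ℕ} (Inv : ℕ → State → Prop)
    (hreg : ∀ k s, Inv k s → s.reg x = k ∧ s.reg y = N)
    (hbody : ∀ k s, k < N → Inv k s →
      Halts p s T fun s' => Inv (k + 1) (s'.setReg x (s'.reg x + s'.reg 1)))
    (k : ℕ) (s : State) (hk : k ≤ N) (hs : Inv k s) :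
    Halts (countUp x y p) s (N * (T + 2) + 1) (Inv N) := by
  suffices H : ∀ d k s, k + d = N → Inv k s →
      Halts (countUp x y p) s (d * (T + 2) + 1) (Inv N) by
    refine (H (N - k) k s (by omega) hs).mono ?_ fun _ h => h
    gcongr
    omega
  intro d
  induction d with
  | zero =>
    intro k s hd h
    obtain ⟨h1, h2⟩ := hreg k s h
    have : k = N := by omega
    subst this
    exact ⟨1, s, .whileFalse (by omega), by omega, h⟩
  | succ d ih =>
    intro k s hd h
    obtain ⟨h1, h2⟩ := hreg k s h
    obtain ⟨t, s', r1, b1, i1⟩ := hbody k s (by omega) h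
    obtain ⟨t', s'', r2, b2, i2⟩ := ih (k + 1) _ (by omega) i1
    refine ⟨1 + (t + 1) + t', s'', .whileTrue (by omega) (.seq r1 (.add s' x x 1)) r2, ?_, i2⟩
    rw [Nat.succ_mul]
    omega

@[simp] lemma State.reg_setReg (s : State) (x v y : ℕ) :
    (s.setReg x v).reg y = if y = x then v else s.reg y := by
  simp [State.setReg, Function.update_apply]

@[simp] lemma State.setReg_setReg (s : State) (x v w : ℕ) :
    (s.setReg x v).setReg x w = s.setReg x w := by
  simp [State.setReg]

@[simp] lemma State.arr_setReg (s : State) (x v : ℕ) : (s.setReg x v).arr = s.arr := rfl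

@[simp] lemma State.reg_setArr (s : State) (a i v : ℕ) : (s.setArr a i v).reg = s.reg := rfl

@[simp] lemma State.arr_setArr (s : State) (a i v b : ℕ) :
    (s.setArr a i v).arr b = if b = a then Function.update (s.arr a) i v else s.arr b := by
  simp [State.setArr, Function.update_apply]

end RAM

/-! ### The program for the path decomposition -/

namespace RAM

/-! Registers: `0` the number `n`, `1` the constant one, `2` and `3` loop counters, `5`, `6`, `7`,
`8` the ends of the current path and their positions, `15` the constant zero. Arrays: `0` the
adjacency matrix, `5` the positions of the vertices, `6` the number of vertices at a position, `7`
the offsets of the rows of the matrix, `8` the points of the vertices. -/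

/-- The registers and arrays which are constant after the initialization. -/
structure Ready (n : ℕ) (A : ℕ → ℕ) (s : State) : Prop where
  size : s.reg 0 = n
  one : s.reg 1 = 1
  zero : s.reg 15 = 0
  matrix : s.arr 0 = A
  row : ∀ u < n, s.arr 7 u = u * n

/-- The matrix `A` with rows of length `n` is the adjacency matrix of `G`. -/
def IsMatrix (G : SimpleGraph ℕ) (n : ℕ) (A : ℕ → ℕ) : Prop :=
  ∀ u < n, ∀ v < n, (0 < A (u * n + v) ↔ G.Adj u v)

variable {G : SimpleGraph ℕ} {n : ℕ} {A : ℕ → ℕ}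

section Rows

/-- The machine cannot multiply, so the row offsets `u * n` are accumulated by addition and stored.
-/
def rowBody : Program := .seq (.store 7 2 4) (.add 4 4 0)

def rowProgram : Program := .seq (.const 1 1) (countUp 2 0 rowBody)

structure RowInv (n : ℕ) (A : ℕ → ℕ) (k : ℕ) (s : State) : Prop where
  size : s.reg 0 = n
  one : s.reg 1 = 1
  zero : s.reg 15 = 0
  matrix : s.arr 0 = A
  pos : s.arr 5 = fun _ => 0
  cnt : s.arr 6 = fun _ => 0
  counter : s.reg 2 = k
  acc : s.reg 4 = k * n
  row : ∀ u < k, s.arr 7 u = u * n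

lemma halts_rowBody {k : ℕ} {s : State} (h : RowInv n A k s) :
    Halts rowBody s 2 fun s' => RowInv n A (k + 1) (s'.setReg 2 (s'.reg 2 + s'.reg 1)) := by
  refine Program.LoopFree.halts (by simp [rowBody, Program.LoopFree]) le_rfl ?_
  obtain ⟨h1, h2, h3, h4, h5, h6, h7, h8, h9⟩ := h
  refine ⟨?_, ?_, ?_, ?_, ?_, ?_, ?_, ?_, ?_⟩ <;>
    simp [rowBody, Program.exec, h1, h2, h3, h4, h5, h6, h7, h8, Nat.succ_mul]
  intro u hu
  by_cases e : u = k
  · subst e; simp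
  · rw [Function.update_of_ne e]; exact h9 u (by omega)

lemma halts_rowProgram {s : State} (hs : s.reg 0 = n) (hr : ∀ x, x ≠ 0 → s.reg x = 0)
    (hA : s.arr 0 = A) (ha : ∀ a, a ≠ 0 → s.arr a = fun _ => 0) :
    Halts rowProgram s (1 + (n * (2 + 2) + 1)) (RowInv n A n) := by
  refine Halts.seq (M := RowInv n A 0)
    (Program.LoopFree.halts (by simp [Program.LoopFree]) le_rfl ?_) ?_
  · refine ⟨?_, ?_, ?_, ?_, ?_, ?_, ?_, ?_, ?_⟩ <;> simp [Program.exec, hs, hr, hA, ha]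
  · intro s' h
    exact halts_countUp (RowInv n A) (fun k s h => ⟨h.counter, h.size⟩)
      (fun k s _ h => halts_rowBody h) 0 s' (by omega) h

end Rows

section Paths

/-- Register `x` gets the value of the counter `3` if this vertex is adjacent to the one whose row
starts at the offset in register `y`. -/
def checkAdj (x y : ℕ) : Program :=
  .seq (.add 9 y 3) (.seq (.load 9 0 9) (.ifLt 15 9 (.add x 3 15) .skip))

/-- Position `0` is recognized by being less than one. For unplaced vertices, register `10` records
any of them, registers `11` and `12` a neighbour of the left and of the right end of the path.
Adding register `15`, which is zero, copies a register. -/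
def scanBody : Program :=
  .seq (.load 9 5 3)
    (.ifLt 9 1 (.seq (.add 10 3 15) (.seq (checkAdj 11 13) (checkAdj 12 14))) .skip)

/-- The value `n` in registers `11` and `12` means that no neighbour has been found. -/
def scanStart : Program :=
  .seq (.load 13 7 5) (.seq (.load 14 7 6) (.seq (.add 11 0 15) (.seq (.add 12 0 15)
    (.const 3 0))))

/-- A new path is begun only when neither end can be extended, as `place_new` requires. -/
def placeVertex : Program :=
  .ifLt 12 0 (.seq (.add 8 8 1) (.seq (.add 6 12 15) (.store 5 6 8)))
    (.ifLt 11 0 (.seq (.sub 7 7 1) (.seq (.add 5 11 15) (.store 5 5 7)))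
      (.seq (.add 8 8 0) (.seq (.add 8 8 1) (.seq (.add 7 8 15) (.seq (.add 5 10 15)
        (.seq (.add 6 10 15) (.store 5 5 8)))))))

def pathBody : Program := .seq (.seq scanStart (countUp 3 0 scanBody)) placeVertex

def pathStart : Program :=
  .seq (.add 8 0 1) (.seq (.add 7 0 1) (.seq (.const 5 0) (.seq (.const 6 0)
    (.seq (.store 5 15 8) (.const 2 1)))))

def pathProgram : Program := .seq pathStart (countUp 2 0 pathBody)

structure PathInv (G : SimpleGraph ℕ) (n : ℕ) (A : ℕ → ℕ) (k : ℕ) (s : State) : Prop where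
  ready : Ready n A s
  cnt : s.arr 6 = fun _ => 0
  counter : s.reg 2 = k
  layout : PathLayout G n (s.arr 5) k (s.reg 5) (s.reg 6) (s.reg 7) (s.reg 8)

/-- Among the vertices below `j`, the search for an unplaced neighbour of `v` has returned `c`. -/
def Searched (G : SimpleGraph ℕ) (n : ℕ) (pos : ℕ → ℕ) (v j c : ℕ) : Prop :=
  (c < n → pos c = 0 ∧ G.Adj v c) ∧ (n ≤ c → ∀ w < j, G.Adj v w → 0 < pos w)

lemma Searched.skip {pos : ℕ → ℕ} {v j c : ℕ} (h : Searched G n pos v j c)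
    (hj : 0 < pos j ∨ ¬ G.Adj v j) : Searched G n pos v (j + 1) c := by
  refine ⟨h.1, fun hc w hw ha => ?_⟩
  rcases Nat.lt_succ_iff_lt_or_eq.1 hw with h1 | rfl
  · exact h.2 hc w h1 ha
  · exact hj.resolve_right fun h => h ha

lemma Searched.found {pos : ℕ → ℕ} {v j : ℕ} (hn : j < n) (hj : pos j = 0) (ha : G.Adj v j) :
    Searched G n pos v (j + 1) j :=
  ⟨fun _ => ⟨hj, ha⟩, fun h => absurd hn (by omega)⟩

structure ScanInv (G : SimpleGraph ℕ) (n : ℕ) (A : ℕ → ℕ) (k j : ℕ) (s : State) : Prop where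
  inv : PathInv G n A k s
  counter : s.reg 3 = j
  row_lo : s.reg 13 = s.reg 5 * n
  row_hi : s.reg 14 = s.reg 6 * n
  any : (∃ w < j, s.arr 5 w = 0) → s.reg 10 < n ∧ s.arr 5 (s.reg 10) = 0
  lo : Searched G n (s.arr 5) (s.reg 5) j (s.reg 11)
  hi : Searched G n (s.arr 5) (s.reg 6) j (s.reg 12)

lemma exec_checkAdj (hA : IsMatrix G n A) {s : State} {x y v j : ℕ} (hx : x ≠ 9)
    (hv : v < n) (hj : j < n) (h3 : s.reg 3 = j) (hy : s.reg y = v * n) (h15 : s.reg 15 = 0)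
    (h0 : s.arr 0 = A) :
    ((checkAdj x y).exec s).arr = s.arr ∧
    (∀ z, z ≠ 9 → z ≠ x → ((checkAdj x y).exec s).reg z = s.reg z) ∧
    ((G.Adj v j → ((checkAdj x y).exec s).reg x = j) ∧
      (¬ G.Adj v j → ((checkAdj x y).exec s).reg x = s.reg x)) := by
  have h := hA v hv j hj
  by_cases ha : G.Adj v j
  · have h' := h.2 ha
    refine ⟨?_, ?_, fun _ => ?_, fun e => absurd ha e⟩
    · simp [checkAdj, Program.exec, h3, hy, h15, h0, h']
    · intro z h9 hz
      simp [checkAdj, Program.exec, h3, hy, h15, h0, h', h9, hz]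
    · simp [checkAdj, Program.exec, h3, hy, h15, h0, h']
  · have h' : ¬ 0 < A (v * n + j) := fun e => ha (h.1 e)
    refine ⟨?_, ?_, fun e => absurd e ha, fun _ => ?_⟩
    · simp only [checkAdj, Program.exec]
      simp [h3, hy, h15, h0, h']
    · intro z h9 hz
      simp [checkAdj, Program.exec, h3, hy, h15, h0, h', h9]
    · simp [checkAdj, Program.exec, h3, hy, h15, h0, h', hx]

lemma halts_scanBody (hA : IsMatrix G n A) {k j : ℕ} {s : State} (hj : j < n)
    (h : ScanInv G n A k j s) :
    Halts scanBody s 11 fun s' => ScanInv G n A k (j + 1)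
      (s'.setReg 3 (s'.reg 3 + s'.reg 1)) := by
  refine Program.LoopFree.halts (by simp [scanBody, checkAdj, Program.LoopFree])
    (by simp [scanBody, checkAdj, Program.cost]) ?_
  obtain ⟨⟨⟨r1, r2, r3, r4, r5⟩, p1, p2, p3⟩, c, h1, h2, h3, h4, h5⟩ := h
  by_cases hu : s.arr 5 j = 0
  · generalize hs1 : (Program.add 10 3 15).exec ((Program.load 9 5 3).exec s) = s1
    have a1 : s1.arr = s.arr := by subst hs1; simp [Program.exec]
    have g1 : ∀ z, z ≠ 9 → z ≠ 10 → s1.reg z = s.reg z := by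
      subst hs1; intro z e1 e2; simp [Program.exec, e1, e2]
    have t1 : s1.reg 10 = j := by subst hs1; simp [Program.exec, r3, c]
    obtain ⟨a2, g2, t2, f2⟩ := exec_checkAdj hA (s := s1) (x := 11) (y := 13) (v := s.reg 5)
      (j := j) (by omega) p3.lo_lt hj (by rw [g1 _ (by omega) (by omega), c])
      (by rw [g1 _ (by omega) (by omega), h1]) (by rw [g1 _ (by omega) (by omega), r3])
      (by rw [a1, r4])
    generalize hs2 : (checkAdj 11 13).exec s1 = s2 at a2 g2 t2 f2
    obtain ⟨a3, g3, t3, f3⟩ := exec_checkAdj hA (s := s2) (x := 12) (y := 14) (v := s.reg 6)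
      (j := j) (by omega) p3.hi_lt hj
      (by rw [g2 _ (by omega) (by omega), g1 _ (by omega) (by omega), c])
      (by rw [g2 _ (by omega) (by omega), g1 _ (by omega) (by omega), h2])
      (by rw [g2 _ (by omega) (by omega), g1 _ (by omega) (by omega), r3])
      (by rw [a2, a1, r4])
    have hexec : scanBody.exec s = (checkAdj 12 14).exec s2 := by
      rw [← hs2, ← hs1]
      simp [scanBody, Program.exec, c, hu, r2]
    rw [hexec]
    generalize (checkAdj 12 14).exec s2 = s3 at a3 g3 t3 f3
    have ha : s3.arr = s.arr := by rw [a3, a2, a1]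
    have hg : ∀ z, z ≠ 9 → z ≠ 10 → z ≠ 11 → z ≠ 12 → s3.reg z = s.reg z := by
      intro z e1 e2 e3 e4; rw [g3 z e1 e4, g2 z e1 e3, g1 z e1 e2]
    have h10 : s3.reg 10 = j := by
      rw [g3 _ (by omega) (by omega), g2 _ (by omega) (by omega), t1]
    have e11 : s3.reg 11 = s2.reg 11 := g3 _ (by omega) (by omega)
    have e11' : s1.reg 11 = s.reg 11 := g1 _ (by omega) (by omega)
    have e12' : s2.reg 12 = s.reg 12 := by
      rw [g2 _ (by omega) (by omega), g1 _ (by omega) (by omega)]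
    refine ⟨⟨⟨?_, ?_, ?_, ?_, ?_⟩, ?_, ?_, ?_⟩, ?_, ?_, ?_, ?_, ?_, ?_⟩ <;>
      simp [ha, hg, h10, e11, r1, r2, r3, r4, p1, p2, c, h1, h2, hu, hj]
    · exact r5
    · exact p3
    · by_cases hadj : G.Adj (s.reg 5) j
      · rw [t2 hadj]; exact .found hj hu hadj
      · rw [f2 hadj, e11']; exact h4.skip (Or.inr hadj)
    · by_cases hadj : G.Adj (s.reg 6) j
      · rw [t3 hadj]; exact .found hj hu hadj
      · rw [f3 hadj, e12']; exact h5.skip (Or.inr hadj)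
  · have hpos : 0 < s.arr 5 j := Nat.pos_of_ne_zero hu
    have hexec : scanBody.exec s = s.setReg 9 (s.arr 5 j) := by
      simp [scanBody, Program.exec, c, r2, hu]
    rw [hexec]
    refine ⟨⟨⟨?_, ?_, ?_, ?_, ?_⟩, ?_, ?_, ?_⟩, ?_, ?_, ?_, ?_, ?_, ?_⟩ <;>
      simp [r1, r2, r3, r4, p1, p2, c, h1, h2]
    · exact r5
    · exact p3
    · intro w hw hw0
      refine h3 ⟨w, ?_, hw0⟩
      have : w ≠ j := fun e => hu (e ▸ hw0)
      omega
    · exact h4.skip (Or.inl hpos)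
    · exact h5.skip (Or.inl hpos)

lemma halts_placeVertex {k : ℕ} {s : State} (hk : k < n) (h : ScanInv G n A k n s) :
    Halts placeVertex s 8 fun s' => PathInv G n A (k + 1)
      (s'.setReg 2 (s'.reg 2 + s'.reg 1)) := by
  refine Program.LoopFree.halts (by simp [placeVertex, Program.LoopFree])
    (by simp [placeVertex, Program.cost]) ?_
  obtain ⟨⟨⟨r1, r2, r3, r4, r5⟩, p1, p2, p3⟩, c, h1, h2, h3, h4, h5⟩ := h
  by_cases hc : s.reg 12 < n
  · obtain ⟨q1, q2⟩ := h5.1 hc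
    refine ⟨⟨?_, ?_, ?_, ?_, ?_⟩, ?_, ?_, ?_⟩ <;>
      simp [placeVertex, Program.exec, hc, r1, r2, r3, r4, p1, p2]
    · exact r5
    · exact p3.place_right hc q1 q2
  · by_cases hb : s.reg 11 < n
    · obtain ⟨q1, q2⟩ := h4.1 hb
      refine ⟨⟨?_, ?_, ?_, ?_, ?_⟩, ?_, ?_, ?_⟩ <;>
        simp [placeVertex, Program.exec, hc, hb, r1, r2, r3, r4, p1, p2]
      · exact r5
      · exact p3.place_left hk hb q1 q2
    · obtain ⟨q1, q2⟩ := h3 (p3.exists_unplaced hk)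
      refine ⟨⟨?_, ?_, ?_, ?_, ?_⟩, ?_, ?_, ?_⟩ <;>
        simp [placeVertex, Program.exec, hc, hb, r1, r2, r3, r4, p1, p2]
      · exact r5
      · exact p3.place_new hk q1 q2 (h4.2 (by omega)) (h5.2 (by omega))

lemma halts_pathBody (hA : IsMatrix G n A) {k : ℕ} {s : State} (hk : k < n)
    (h : PathInv G n A k s) :
    Halts pathBody s (5 + (n * (11 + 2) + 1) + 8) fun s' => PathInv G n A (k + 1)
      (s'.setReg 2 (s'.reg 2 + s'.reg 1)) := by
  refine Halts.seq (Halts.seq (M := ScanInv G n A k 0)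
    (Program.LoopFree.halts (by simp [scanStart, Program.LoopFree]) le_rfl ?_)
    fun s' hs' => halts_countUp (ScanInv G n A k) (fun j s h => ⟨h.counter, h.inv.ready.size⟩)
      (fun j s hj h => halts_scanBody hA hj h) 0 s' (by omega) hs')
    fun s' hs' => halts_placeVertex hk hs'
  obtain ⟨⟨r1, r2, r3, r4, r5⟩, p1, p2, p3⟩ := h
  have e1 := r5 _ p3.lo_lt
  have e2 := r5 _ p3.hi_lt
  refine ⟨⟨⟨?_, ?_, ?_, ?_, ?_⟩, ?_, ?_, ?_⟩, ?_, ?_, ?_, ?_, ?_, ?_⟩ <;>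
    simp [scanStart, Program.exec, r1, r2, r3, r4, p1, p2, e1, e2, Searched]
  · exact r5
  · exact p3

lemma halts_pathProgram (hA : IsMatrix G n A) (hn : 0 < n) {s : State} (h : RowInv n A n s) :
    Halts pathProgram s (6 + (n * (5 + (n * (11 + 2) + 1) + 8 + 2) + 1)) (PathInv G n A n) := by
  refine Halts.seq (M := PathInv G n A 1)
    (Program.LoopFree.halts (by simp [pathStart, Program.LoopFree]) le_rfl ?_)
    fun s' hs' => halts_countUp (PathInv G n A) (fun k s h => ⟨h.counter, h.ready.size⟩)
      (fun k s hk h => halts_pathBody hA hk h) 1 s' (by omega) hs'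
  obtain ⟨h1, h2, h3, h4, h5, h6, h7, h8, h9⟩ := h
  refine ⟨⟨?_, ?_, ?_, ?_, ?_⟩, ?_, ?_, ?_⟩ <;>
    simp [pathStart, Program.exec, h1, h2, h3, h4, h5, h6]
  · exact h9
  · exact PathLayout.single G hn

end Paths

end RAM

/-! ### The program for counting ends and attaching points -/

namespace RAM

variable {G : SimpleGraph ℕ} {n : ℕ} {A : ℕ → ℕ}

section Count

def countBody : Program :=
  .seq (.load 9 5 2) (.seq (.load 10 6 9) (.seq (.add 10 10 1) (.seq (.store 6 9 10)
    (.seq (.add 9 9 1) (.seq (.load 10 6 9) (.seq (.add 10 10 1) (.seq (.store 6 9 10)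
      (.seq (.store 8 2 4) (.add 4 4 1)))))))))

def countProgram : Program :=
  .seq (.seq (.const 2 0) (.seq (.add 4 8 1) (.add 4 4 1))) (countUp 2 0 countBody)

structure CountInv (G : SimpleGraph ℕ) (n : ℕ) (A : ℕ → ℕ) (k : ℕ) (s : State) : Prop where
  ready : Ready n A s
  counter : s.reg 2 = k
  acc : s.reg 4 = s.reg 8 + 2 + k
  layout : PathLayout G n (s.arr 5) n (s.reg 5) (s.reg 6) (s.reg 7) (s.reg 8)
  cnt : s.arr 6 = fun x => ∑ v ∈ Finset.range k,
    ((if s.arr 5 v = x then 1 else 0) + (if s.arr 5 v + 1 = x then 1 else 0))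
  point : ∀ v < k, s.arr 8 v = s.reg 8 + 2 + v

lemma halts_countBody {k : ℕ} {s : State} (h : CountInv G n A k s) :
    Halts countBody s 10 fun s' => CountInv G n A (k + 1)
      (s'.setReg 2 (s'.reg 2 + s'.reg 1)) := by
  refine Program.LoopFree.halts (by simp [countBody, Program.LoopFree]) le_rfl ?_
  obtain ⟨⟨r1, r2, r3, r4, r5⟩, h1, h2, h3, h4, h5⟩ := h
  refine ⟨⟨?_, ?_, ?_, ?_, ?_⟩, ?_, ?_, ?_, ?_, ?_⟩ <;>
    simp [countBody, Program.exec, r1, r2, r3, r4, h1, h2]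
  · exact r5
  · omega
  · exact h3
  · funext x
    rw [Finset.sum_range_succ, h4]
    simp only [Function.update_apply]
    split_ifs <;> first | omega | (subst_vars; simp_all)
  · intro v hv
    by_cases e : v = k
    · subst e; simp
    · rw [Function.update_of_ne e]; exact h5 v (by omega)

lemma halts_countProgram {s : State} (h : PathInv G n A n s) :
    Halts countProgram s (3 + (n * (10 + 2) + 1)) (CountInv G n A n) := by
  refine Halts.seq (M := CountInv G n A 0)
    (Program.LoopFree.halts (by simp [Program.LoopFree]) le_rfl ?_)
    fun s' hs' => halts_countUp (CountInv G n A) (fun k s h => ⟨h.counter, h.ready.size⟩)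
      (fun k s _ h => halts_countBody h) 0 s' (by omega) hs'
  obtain ⟨⟨r1, r2, r3, r4, r5⟩, p1, p2, p3⟩ := h
  refine ⟨⟨?_, ?_, ?_, ?_, ?_⟩, ?_, ?_, ?_, ?_, ?_⟩ <;>
    simp [Program.exec, r1, r2, r3, r4, p1]
  · exact r5
  · exact p3

end Count

section Edges

/-- The counts at the two ends of each segment are added; the vertex with the larger sum gives its
point, ties going to register `2`. -/
def chooseEnds : Program :=
  .seq (.load 13 6 9) (.seq (.add 11 9 1) (.seq (.load 14 6 11) (.seq (.add 13 13 14)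
    (.seq (.load 14 6 10) (.seq (.add 11 10 1) (.seq (.load 11 6 11) (.seq (.add 14 14 11)
      (.ifLt 13 14 (.seq (.add 4 3 15) (.add 9 2 15)) (.seq (.add 4 2 15) (.add 9 3 15))))))))))

def attachPoint : Program :=
  .seq (.seq (.load 10 5 9) (.seq (.load 11 6 10) (.ifLt 1 11
    (.seq (.add 10 10 1) (.seq (.load 11 6 10) (.ifLt 1 11 (.load 10 8 9) .skip))) .skip)))
    (.seq (.store 8 4 10) (.seq (.add 11 1 1) (.store 6 10 11)))

/-- The sum of the two truncated differences is the distance of the positions. For distinct vertices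
it exceeds one exactly when they are not consecutive. -/
def edgeTest : Program :=
  .seq (.load 9 5 2) (.seq (.load 10 5 3) (.seq (.sub 11 9 10) (.seq (.sub 12 10 9)
    (.add 11 11 12))))

def edgeBody : Program :=
  .seq (.seq (.load 9 7 2) (.seq (.add 9 9 3) (.load 9 0 9)))
    (.ifLt 15 9 (.seq edgeTest (.ifLt 1 11 (.seq chooseEnds attachPoint) .skip)) .skip)

/-- The inner counter runs only up to the outer one, so every edge is treated once. -/
def edgeProgram : Program :=
  .seq (.const 2 0) (countUp 2 0 (.seq (.const 3 0) (countUp 3 2 edgeBody)))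

/-- The edges between consecutive vertices and those which come before the pair `i`, `j`. -/
def Done (G : SimpleGraph ℕ) (pos : ℕ → ℕ) (i j u v : ℕ) : Prop :=
  G.Adj u v ∧ (Consecutive pos u v ∨ max u v < i ∨ (max u v = i ∧ min u v < j))

structure EdgeInv (G : SimpleGraph ℕ) (n : ℕ) (A : ℕ → ℕ) (i j : ℕ) (s : State) : Prop where
  ready : Ready n A s
  fst : s.reg 2 = i
  snd : s.reg 3 = j
  layout : PathLayout G n (s.arr 5) n (s.reg 5) (s.reg 6) (s.reg 7) (s.reg 8)
  attached : Attached G n (s.arr 5) (s.arr 8) (s.arr 6) (Done G (s.arr 5) i j)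

lemma done_succ_of_adj {pos : ℕ → ℕ} {i j : ℕ} (hij : j < i) (ha : G.Adj i j) (u v : ℕ) :
    Done G pos i (j + 1) u v ↔ Done G pos i j u v ∨ (u = i ∧ v = j) ∨ (u = j ∧ v = i) := by
  constructor
  · rintro ⟨h1, h2 | h2 | h2⟩
    · exact Or.inl ⟨h1, Or.inl h2⟩
    · exact Or.inl ⟨h1, Or.inr (Or.inl h2)⟩
    · by_cases h : min u v < j
      · exact Or.inl ⟨h1, Or.inr (Or.inr ⟨h2.1, h⟩)⟩
      · exact Or.inr (by omega)
  · rintro (⟨h1, h2 | h2 | h2⟩ | ⟨rfl, rfl⟩ | ⟨rfl, rfl⟩)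
    · exact ⟨h1, Or.inl h2⟩
    · exact ⟨h1, Or.inr (Or.inl h2)⟩
    · exact ⟨h1, Or.inr (Or.inr (by omega))⟩
    · exact ⟨ha, Or.inr (Or.inr (by omega))⟩
    · exact ⟨ha.symm, Or.inr (Or.inr (by omega))⟩

lemma done_succ_of_not {pos : ℕ → ℕ} {i j : ℕ} (h : ¬ (G.Adj i j ∧ ¬ Consecutive pos i j))
    (u v : ℕ) : Done G pos i j u v ↔ Done G pos i (j + 1) u v := by
  constructor
  · rintro ⟨h1, h2 | h2 | h2⟩
    · exact ⟨h1, Or.inl h2⟩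
    · exact ⟨h1, Or.inr (Or.inl h2)⟩
    · exact ⟨h1, Or.inr (Or.inr (by omega))⟩
  · rintro ⟨h1, h2 | h2 | h2⟩
    · exact ⟨h1, Or.inl h2⟩
    · exact ⟨h1, Or.inr (Or.inl h2)⟩
    · by_cases h3 : min u v < j
      · exact ⟨h1, Or.inr (Or.inr ⟨h2.1, h3⟩)⟩
      · refine ⟨h1, Or.inl ?_⟩
        rcases le_total u v with h4 | h4
        · have e1 : v = i := by omega
          have e2 : u = j := by omega
          subst e1 e2
          by_contra hc
          exact h ⟨h1.symm, fun c => hc c.symm⟩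
        · have e1 : u = i := by omega
          have e2 : v = j := by omega
          subst e1 e2
          by_contra hc
          exact h ⟨h1, hc⟩

/-- Counts are at most 2, so both ends are used exactly when the sum is 4. If the larger sum is
below 4, the smaller one is as well, which gives the last alternative. -/
lemma exec_chooseEnds {s : State} {i j : ℕ} (h1 : s.reg 1 = 1) (h15 : s.reg 15 = 0)
    (h2 : s.reg 2 = i) (h3 : s.reg 3 = j) (h9 : s.reg 9 = s.arr 5 i) (h10 : s.reg 10 = s.arr 5 j)
    (hle : ∀ x, s.arr 6 x ≤ 2) :
    (chooseEnds.exec s).arr = s.arr ∧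
    (∀ z, z < 4 ∨ 4 < z ∧ z < 9 ∨ z = 15 → (chooseEnds.exec s).reg z = s.reg z) ∧
    ∃ u v, (chooseEnds.exec s).reg 4 = u ∧ (chooseEnds.exec s).reg 9 = v ∧
      ((u = i ∧ v = j) ∨ (u = j ∧ v = i)) ∧
      (EndsUsed (s.arr 5) (s.arr 6) u ∨ ¬ EndsUsed (s.arr 5) (s.arr 6) v) := by
  have b1 := hle (s.arr 5 i)
  have b2 := hle (s.arr 5 i + 1)
  have b3 := hle (s.arr 5 j)
  have b4 := hle (s.arr 5 j + 1)
  by_cases h : s.arr 6 (s.arr 5 i) + s.arr 6 (s.arr 5 i + 1) <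
      s.arr 6 (s.arr 5 j) + s.arr 6 (s.arr 5 j + 1)
  · refine ⟨?_, ?_, j, i, ?_, ?_, Or.inr ⟨rfl, rfl⟩, ?_⟩
    · simp [chooseEnds, Program.exec, h1, h15, h2, h3, h9, h10, h]
    · intro z hz
      have e4 : z ≠ 4 := by omega
      have e9 : z ≠ 9 := by omega
      have e11 : z ≠ 11 := by omega
      have e13 : z ≠ 13 := by omega
      have e14 : z ≠ 14 := by omega
      simp [chooseEnds, Program.exec, h1, h15, h2, h3, h9, h10, h, e4, e9, e11, e13, e14]
    · simp [chooseEnds, Program.exec, h1, h15, h2, h3, h9, h10, h]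
    · simp [chooseEnds, Program.exec, h1, h15, h2, h3, h9, h10, h]
    · unfold EndsUsed; omega
  · refine ⟨?_, ?_, i, j, ?_, ?_, Or.inl ⟨rfl, rfl⟩, ?_⟩
    · simp [chooseEnds, Program.exec, h1, h15, h2, h3, h9, h10, h]
    · intro z hz
      have e4 : z ≠ 4 := by omega
      have e9 : z ≠ 9 := by omega
      have e11 : z ≠ 11 := by omega
      have e13 : z ≠ 13 := by omega
      have e14 : z ≠ 14 := by omega
      simp [chooseEnds, Program.exec, h1, h15, h2, h3, h9, h10, h, e4, e9, e11, e13, e14]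
    · simp [chooseEnds, Program.exec, h1, h15, h2, h3, h9, h10, h]
    · simp [chooseEnds, Program.exec, h1, h15, h2, h3, h9, h10, h]
    · unfold EndsUsed; omega

lemma exec_attachPoint {s : State} {u v : ℕ} (h1 : s.reg 1 = 1) (h4 : s.reg 4 = u)
    (h9 : s.reg 9 = v) :
    (∀ a, a ≠ 8 → a ≠ 6 → (attachPoint.exec s).arr a = s.arr a) ∧
    (attachPoint.exec s).arr 8 =
      Function.update (s.arr 8) u (slot (s.arr 5) (s.arr 8) (s.arr 6) v) ∧
    (attachPoint.exec s).arr 6 =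
      Function.update (s.arr 6) (slot (s.arr 5) (s.arr 8) (s.arr 6) v) 2 ∧
    (∀ z, z < 9 ∨ z = 15 → (attachPoint.exec s).reg z = s.reg z) := by
  unfold slot
  by_cases c1 : s.arr 6 (s.arr 5 v) < 2
  · have d1 : ¬ 1 < s.arr 6 (s.arr 5 v) := by omega
    refine ⟨fun a e1 e2 => ?_, ?_, ?_, fun z hz => ?_⟩
    · simp [attachPoint, Program.exec, h1, h9, d1, e1, e2]
    · simp [attachPoint, Program.exec, h1, h4, h9, d1, c1]
    · simp [attachPoint, Program.exec, h1, h9, d1, c1]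
    · have e10 : z ≠ 10 := by omega
      have e11 : z ≠ 11 := by omega
      simp [attachPoint, Program.exec, h1, h9, d1, e10, e11]
  · have d1 : 1 < s.arr 6 (s.arr 5 v) := by omega
    by_cases c2 : s.arr 6 (s.arr 5 v + 1) < 2
    · have d2 : ¬ 1 < s.arr 6 (s.arr 5 v + 1) := by omega
      refine ⟨fun a e1 e2 => ?_, ?_, ?_, fun z hz => ?_⟩
      · simp [attachPoint, Program.exec, h1, h9, d1, d2, e1, e2]
      · simp [attachPoint, Program.exec, h1, h4, h9, d1, d2, c1, c2]
      · simp [attachPoint, Program.exec, h1, h9, d1, d2, c1, c2]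
      · have e10 : z ≠ 10 := by omega
        have e11 : z ≠ 11 := by omega
        simp [attachPoint, Program.exec, h1, h9, d1, d2, e10, e11]
    · have d2 : 1 < s.arr 6 (s.arr 5 v + 1) := by omega
      refine ⟨fun a e1 e2 => ?_, ?_, ?_, fun z hz => ?_⟩
      · simp [attachPoint, Program.exec, h1, h9, d1, d2, e1, e2]
      · simp [attachPoint, Program.exec, h1, h4, h9, d1, d2, c1, c2]
      · simp [attachPoint, Program.exec, h1, h9, d1, d2, c1, c2]
      · have e10 : z ≠ 10 := by omega
        have e11 : z ≠ 11 := by omega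
        simp [attachPoint, Program.exec, h1, h9, d1, d2, e10, e11]

lemma halts_edgeBody (hA : IsMatrix G n A)
    (hdeg : ∀ u a b c d, G.Adj u a → G.Adj u b → G.Adj u c → G.Adj u d →
      a ≠ b → a ≠ c → a ≠ d → b ≠ c → b ≠ d → c ≠ d → False)
    {i j : ℕ} {s : State} (hi : i < n) (hj : j < i) (h : EdgeInv G n A i j s) :
    Halts edgeBody s 40 fun s' => EdgeInv G n A i (j + 1)
      (s'.setReg 3 (s'.reg 3 + s'.reg 1)) := by
  refine Program.LoopFree.halts
    (by simp [edgeBody, edgeTest, chooseEnds, attachPoint, Program.LoopFree])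
    (by simp [edgeBody, edgeTest, chooseEnds, attachPoint, Program.cost]) ?_
  obtain ⟨⟨r1, r2, r3, r4, r5⟩, h1, h2, h3, h4⟩ := h
  have hjn : j < n := by omega
  have hm := hA i hi j hjn
  have hrow := r5 i hi
  have unchanged : ¬ (G.Adj i j ∧ ¬ Consecutive (s.arr 5) i j) →
      ∀ s' : State, s'.arr = s.arr → (∀ z, z < 9 ∨ z = 15 → s'.reg z = s.reg z) →
      EdgeInv G n A i (j + 1) (s'.setReg 3 (s'.reg 3 + s'.reg 1)) := by
    intro hc s' e1 e2
    refine ⟨⟨?_, ?_, ?_, ?_, ?_⟩, ?_, ?_, ?_, ?_⟩ <;> simp [e1, e2, r1, r2, r3, r4, h1, h2]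
    · exact r5
    · exact h3
    · exact h4.congr (done_succ_of_not hc)
  by_cases ha : G.Adj i j
  · have hpA := hm.2 ha
    have hexec : edgeBody.exec s = (Program.ifLt 1 11 (.seq chooseEnds attachPoint) .skip).exec
        (edgeTest.exec (s.setReg 9 (A (i * n + j)))) := by
      simp [edgeBody, edgeTest, Program.exec, r3, r4, h1, h2, hrow, hpA]
    rw [hexec]
    generalize hs1 : edgeTest.exec (s.setReg 9 (A (i * n + j))) = s1
    have a1 : s1.arr = s.arr := by subst hs1; simp [edgeTest, Program.exec]
    have g1 : ∀ z, z < 9 ∨ z = 15 → s1.reg z = s.reg z := by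
      subst hs1
      intro z hz
      have e9 : z ≠ 9 := by omega
      have e10 : z ≠ 10 := by omega
      have e11 : z ≠ 11 := by omega
      have e12 : z ≠ 12 := by omega
      simp [edgeTest, Program.exec, e9, e10, e11, e12]
    have t9 : s1.reg 9 = s.arr 5 i := by subst hs1; simp [edgeTest, Program.exec, h1]
    have t10 : s1.reg 10 = s.arr 5 j := by subst hs1; simp [edgeTest, Program.exec, h2]
    have t11 : s1.reg 11 = (s.arr 5 i - s.arr 5 j) + (s.arr 5 j - s.arr 5 i) := by
      subst hs1; simp [edgeTest, Program.exec, h1, h2]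
    have t1 : s1.reg 1 = 1 := by rw [g1 1 (by omega), r2]
    have hne : s.arr 5 i ≠ s.arr 5 j := fun e =>
      ha.ne (h3.inj i hi j hjn (h3.all_placed hi) e)
    by_cases hc : Consecutive (s.arr 5) i j
    · have hlt : ¬ s1.reg 1 < s1.reg 11 := by
        unfold Consecutive at hc; omega
      simp only [Program.exec, if_neg hlt]
      exact unchanged (fun e => e.2 hc) s1 a1 g1
    · have hlt : s1.reg 1 < s1.reg 11 := by
        unfold Consecutive at hc; omega
      simp only [Program.exec, if_pos hlt]
      obtain ⟨a2, g2, u, v, t4, t9', huv, hf⟩ := exec_chooseEnds (s := s1) (i := i) (j := j) t1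
        (by rw [g1 15 (by omega), r3]) (by rw [g1 2 (by omega), h1]) (by rw [g1 3 (by omega), h2])
        (by rw [t9, a1]) (by rw [t10, a1]) (by rw [a1]; exact h4.occ_le)
      generalize chooseEnds.exec s1 = s2 at a2 g2 t4 t9'
      obtain ⟨a3, a8, a6, g3⟩ := exec_attachPoint (s := s2) (u := u) (v := v)
        (by rw [g2 1 (by omega), t1]) t4 t9'
      generalize attachPoint.exec s2 = s3 at a3 a8 a6 g3
      rw [a2, a1] at a8 a6
      rw [a1] at hf
      have ha' : ∀ a, a ≠ 8 → a ≠ 6 → s3.arr a = s.arr a := by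
        intro a e1 e2; rw [a3 a e1 e2, a2, a1]
      have hg : ∀ z, z < 4 ∨ 4 < z ∧ z < 9 ∨ z = 15 → s3.reg z = s.reg z := by
        intro z hz; rw [g3 z (by omega), g2 z hz, g1 z (by omega)]
      have hnd : ¬ Done G (s.arr 5) i j i j := by
        rintro ⟨_, h | h | h⟩
        · exact hc h
        · omega
        · omega
      have hsymm : Done G (s.arr 5) i j j i → Done G (s.arr 5) i j i j := fun e => h4.symm _ _ e
      have hstep : Attached G n (s.arr 5) (s3.arr 8) (s3.arr 6) (Done G (s.arr 5) i (j + 1)) := by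
        rw [a8, a6]
        rcases huv with ⟨rfl, rfl⟩ | ⟨rfl, rfl⟩
        · exact (h4.attach h3 hdeg hi hjn ha hnd hc hf).congr fun a b =>
            (done_succ_of_adj hj ha a b).symm
        · refine (h4.attach h3 hdeg hjn hi ha.symm (fun e => hnd (hsymm e))
            (fun e => hc e.symm) hf).congr fun a b => ?_
          rw [done_succ_of_adj hj ha a b, or_comm (a := a = v ∧ b = u)]
      refine ⟨⟨?_, ?_, ?_, ?_, ?_⟩, ?_, ?_, ?_, ?_⟩ <;>
        simp [ha', hg, r1, r2, r3, r4, h1, h2]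
      · exact r5
      · exact h3
      · exact hstep
  · have hpA : ¬ 0 < A (i * n + j) := fun e => ha (hm.1 e)
    have hexec : edgeBody.exec s = s.setReg 9 (A (i * n + j)) := by
      simp only [edgeBody, Program.exec]
      simp [r3, r4, h1, h2, hrow, hpA]
    rw [hexec]
    refine unchanged (fun e => ha e.1) _ rfl fun z hz => ?_
    have e9 : z ≠ 9 := by omega
    simp [e9]

lemma halts_edgeProgram (hA : IsMatrix G n A)
    (hdeg : ∀ u a b c d, G.Adj u a → G.Adj u b → G.Adj u c → G.Adj u d →
      a ≠ b → a ≠ c → a ≠ d → b ≠ c → b ≠ d → c ≠ d → False)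
    {s : State} (h : CountInv G n A n s) :
    Halts edgeProgram s (1 + (n * (1 + (n * (40 + 2) + 1) + 2) + 1))
      fun s' => EdgeInv G n A n 0 (s'.setReg 3 0) := by
  -- Each outer round begins by resetting register `3`, so the outer invariant is stated for the
  -- state after this reset.
  refine Halts.seq (M := fun s => EdgeInv G n A 0 0 (s.setReg 3 0))
    (Program.LoopFree.halts (by simp [Program.LoopFree]) le_rfl ?_)
    fun s' hs' => halts_countUp (fun i s => EdgeInv G n A i 0 (s.setReg 3 0))
      (fun k s h => ⟨by simpa using h.fst, by simpa using h.ready.size⟩) ?_ 0 s' (by omega) hs'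
  · obtain ⟨⟨r1, r2, r3, r4, r5⟩, h1, h2, h3, h4, h5⟩ := h
    refine ⟨⟨?_, ?_, ?_, ?_, ?_⟩, ?_, ?_, ?_, ?_⟩ <;>
      simp [Program.exec, r1, r2, r3, r4]
    · exact r5
    · exact h3
    · rw [h4]
      refine (Attached.initial h3 h5).congr fun u v => ?_
      constructor
      · rintro ⟨e1, e2⟩
        exact ⟨e1, Or.inl e2⟩
      · rintro ⟨e1, e2 | e2 | e2⟩
        · exact ⟨e1, e2⟩
        · omega
        · omega
  · intro i s hi h
    refine Halts.seq (M := EdgeInv G n A i 0)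
      (Program.LoopFree.halts (T := 1) (by simp [Program.LoopFree]) le_rfl h) fun s' hs' => ?_
    refine (halts_countUp (EdgeInv G n A i) (fun j s h => ⟨h.snd, h.fst⟩)
      (fun j s hj h => halts_edgeBody hA hdeg hi hj h) 0 s' (by omega) hs').mono ?_ ?_
    · gcongr
    · rintro t ⟨⟨r1, r2, r3, r4, r5⟩, h1, h2, h3, h4⟩
      refine ⟨⟨?_, ?_, ?_, ?_, ?_⟩, ?_, ?_, ?_, ?_⟩ <;> simp [r1, r2, r3, r4, h1]
      · exact r5
      · exact h3
      -- After the inner loop all pairs with maximum `i` are done, because adjacent vertices differ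
      -- and so the minimum is below `i`.
      · refine h4.congr fun u v => and_congr_right fun ha => or_congr_right ?_
        have := ha.ne
        omega

end Edges

/-! ### Writing the endpoints and assembling the program -/

section Output

def outputBody : Program :=
  .seq (.load 9 5 2) (.seq (.load 10 8 2) (.seq (.add 11 9 1) (.ifLt 10 9
    (.seq (.store 1 2 10) (.seq (.store 2 2 10) (.seq (.store 3 2 9) (.store 4 2 11))))
    (.seq (.store 1 2 9) (.seq (.store 2 2 11) (.seq (.store 3 2 10) (.store 4 2 10)))))))

def outputProgram : Program := .seq (.const 2 0) (countUp 2 0 outputBody)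

/-- The cells `u` of the arrays `1` to `4` hold the segment and the point of `u`. -/
def Written (pos pt : ℕ → ℕ) (s : State) (u : ℕ) : Prop :=
  (s.arr 1 u = pt u ∧ s.arr 2 u = pt u ∧ s.arr 3 u = pos u ∧ s.arr 4 u = pos u + 1) ∨
    (s.arr 1 u = pos u ∧ s.arr 2 u = pos u + 1 ∧ s.arr 3 u = pt u ∧ s.arr 4 u = pt u)

structure OutputInv (n : ℕ) (pos pt : ℕ → ℕ) (k : ℕ) (s : State) : Prop where
  size : s.reg 0 = n
  one : s.reg 1 = 1
  counter : s.reg 2 = k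
  segment : s.arr 5 = pos
  point : s.arr 8 = pt
  written : ∀ u < k, Written pos pt s u

lemma halts_outputBody {pos pt : ℕ → ℕ} {k : ℕ} {s : State} (h : OutputInv n pos pt k s) :
    Halts outputBody s 8 fun s' => OutputInv n pos pt (k + 1)
      (s'.setReg 2 (s'.reg 2 + s'.reg 1)) := by
  refine Program.LoopFree.halts (by simp [outputBody, Program.LoopFree])
    (by simp [outputBody, Program.cost]) ?_
  obtain ⟨h1, h2, h3, h4, h5, h6⟩ := h
  by_cases hlt : pt k < pos k
  · refine ⟨?_, ?_, ?_, ?_, ?_, ?_⟩ <;>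
      simp [outputBody, Program.exec, h1, h2, h3, h4, h5, hlt]
    intro u hu
    by_cases e : u = k
    · subst e; exact Or.inl (by simp)
    · simpa [Written, e] using h6 u (by omega)
  · refine ⟨?_, ?_, ?_, ?_, ?_, ?_⟩ <;>
      simp [outputBody, Program.exec, h1, h2, h3, h4, h5, hlt]
    intro u hu
    by_cases e : u = k
    · subst e; exact Or.inr (by simp)
    · simpa [Written, e] using h6 u (by omega)

lemma halts_outputProgram {s : State} (h0 : s.reg 0 = n) (h1 : s.reg 1 = 1) :
    Halts outputProgram s (1 + (n * (8 + 2) + 1)) (OutputInv n (s.arr 5) (s.arr 8) n) := by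
  refine Halts.seq (M := OutputInv n (s.arr 5) (s.arr 8) 0)
    (Program.LoopFree.halts (by simp [Program.LoopFree]) le_rfl ?_)
    fun s' hs' => halts_countUp (OutputInv n (s.arr 5) (s.arr 8))
      (fun k s h => ⟨h.counter, h.size⟩) (fun k s _ h => halts_outputBody h) 0 s' (by omega) hs'
  refine ⟨?_, ?_, ?_, ?_, ?_, ?_⟩ <;> simp [Program.exec, h0, h1]

end Output

/-- The program that computes the representation. -/
def representationProgram : Program :=
  .seq rowProgram (.seq pathProgram (.seq countProgram (.seq edgeProgram outputProgram)))

/-- The program ends in a state whose arrays hold a segment and a point of each vertex. -/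
lemma halts_representationProgram (hA : IsMatrix G n A) (hn : 0 < n)
    (hdeg : ∀ u a b c d, G.Adj u a → G.Adj u b → G.Adj u c → G.Adj u d →
      a ≠ b → a ≠ c → a ≠ d → b ≠ c → b ≠ d → c ≠ d → False)
    {s : State} (hs : s.reg 0 = n) (hr : ∀ x, x ≠ 0 → s.reg x = 0)
    (hs0 : s.arr 0 = A) (ha : ∀ a, a ≠ 0 → s.arr a = fun _ => 0) :
    Halts representationProgram s (200 * (n + 1) ^ 2) fun s' => ∃ pos pt : ℕ → ℕ,
      (∀ u < n, Written pos pt s' u) ∧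
      (∀ u < n, ∀ v < n, pos u = pos v → u = v) ∧
      (∀ u < n, pt u ≠ pos u ∧ pt u ≠ pos u + 1) ∧
      (∀ u < n, ∀ v < n, u ≠ v →
        ((∃ x, Touches pos pt u x ∧ Touches pos pt v x) ↔ G.Adj u v)) := by
  refine ((halts_rowProgram hs hr hs0 ha).seq fun s₁ h₁ => (halts_pathProgram hA hn h₁).seq
    fun s₂ h₂ => (halts_countProgram h₂).seq fun s₃ h₃ => (halts_edgeProgram hA hdeg h₃).seq
    (Q := fun s' => ∃ pos pt : ℕ → ℕ,
      (∀ u < n, Written pos pt s' u) ∧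
      (∀ u < n, ∀ v < n, pos u = pos v → u = v) ∧
      (∀ u < n, pt u ≠ pos u ∧ pt u ≠ pos u + 1) ∧
      (∀ u < n, ∀ v < n, u ≠ v →
        ((∃ x, Touches pos pt u x ∧ Touches pos pt v x) ↔ G.Adj u v)))
    fun s₄ h₄ => (halts_outputProgram (n := n) (by simpa using h₄.ready.size)
      (by simpa using h₄.ready.one)).mono le_rfl fun s' h' => ?_).mono ?_ fun _ h => h
  · obtain ⟨_, _, _, hl, hatt⟩ := h₄
    simp only [State.arr_setReg] at hl hatt
    refine ⟨s₄.arr 5, s₄.arr 8, h'.written,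
      fun u hu v hv e => hl.inj u hu v hv (hl.all_placed hu) e, hatt.proper,
      fun u hu v hv huv => ?_⟩
    rw [hatt.meet u hu v hv huv]
    exact ⟨fun h => h.1, fun h => ⟨h, Or.inr (Or.inl (by omega))⟩⟩
  -- The five bounds add up to `55 * n ^ 2 + 46 * n + 17`.
  · nlinarith

end RAM

/-! ### Graphs on `Fin n` as machine input -/

lemma adj_map_val {n : ℕ} {G : SimpleGraph (Fin n)} {a b : ℕ} :
    (G.map Fin.valEmbedding).Adj a b ↔ ∃ u v : Fin n, G.Adj u v ∧ (u : ℕ) = a ∧ (v : ℕ) = b :=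
  SimpleGraph.map_adj _ _ _ _

lemma IsBoundedDegreeThree.not_four_neighbors {n : ℕ} {G : SimpleGraph (Fin n)}
    (h : IsBoundedDegreeThree G) (u a b c d : ℕ) (ha : (G.map Fin.valEmbedding).Adj u a)
    (hb : (G.map Fin.valEmbedding).Adj u b) (hc : (G.map Fin.valEmbedding).Adj u c)
    (hd : (G.map Fin.valEmbedding).Adj u d) (hab : a ≠ b) (hac : a ≠ c) (had : a ≠ d)
    (hbc : b ≠ c) (hbd : b ≠ d) (hcd : c ≠ d) : False := by
  rw [adj_map_val] at ha hb hc hd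
  obtain ⟨u, a, ha, rfl, rfl⟩ := ha
  obtain ⟨u', b, hb, e, rfl⟩ := hb
  obtain rfl := Fin.val_injective e
  obtain ⟨u', c, hc, e, rfl⟩ := hc
  obtain rfl := Fin.val_injective e
  obtain ⟨u', d, hd, e, rfl⟩ := hd
  obtain rfl := Fin.val_injective e
  have hab' : a ≠ b := fun e => hab (congrArg _ e)
  have hac' : a ≠ c := fun e => hac (congrArg _ e)
  have had' : a ≠ d := fun e => had (congrArg _ e)
  have hbc' : b ≠ c := fun e => hbc (congrArg _ e)
  have hbd' : b ≠ d := fun e => hbd (congrArg _ e)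
  have hcd' : c ≠ d := fun e => hcd (congrArg _ e)
  have hcard : ({a, b, c, d} : Finset (Fin n)).card = 4 := by
    rw [Finset.card_insert_of_notMem (by simp [hab', hac', had']),
      Finset.card_insert_of_notMem (by simp [hbc', hbd']),
      Finset.card_insert_of_notMem (by simp [hcd']), Finset.card_singleton]
  have hsub : (({a, b, c, d} : Finset (Fin n)) : Set (Fin n)) ⊆ G.neighborSet u' := by
    intro x hx
    simp only [Finset.coe_insert, Finset.coe_singleton, Set.mem_insert_iff,
      Set.mem_singleton_iff] at hx
    rcases hx with rfl | rfl | rfl | rfl <;> assumption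
  have := (Set.encard_le_encard hsub).trans (h.2 _)
  rw [Set.encard_coe_eq_coe_finsetCard, hcard] at this
  exact absurd this (by norm_num)

/-- Since `v < n`, division by `n` recovers `u`, and then `v`, from the index `u * n + v`. -/
lemma isMatrix_graphInput {n : ℕ} (G : SimpleGraph (Fin n)) :
    RAM.IsMatrix (G.map Fin.valEmbedding) n ((RAM.graphInput G).arr 0) := by
  intro u hu v hv
  rw [adj_map_val]
  simp only [RAM.graphInput]
  constructor
  · intro h
    split_ifs at h with hc
    · obtain ⟨-, a, b, hab, e⟩ := hc
      have hn : 0 < n := by omega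
      have h1 : u = a := by
        have := congrArg (· / n) e
        simpa [Nat.mul_comm _ n, Nat.mul_add_div hn, Nat.div_eq_of_lt hv,
          Nat.div_eq_of_lt b.isLt] using this
      have h2 : v = b := by rw [h1] at e; omega
      exact ⟨a, b, hab, h1.symm, h2.symm⟩
    · omega
  · rintro ⟨a, b, hab, rfl, rfl⟩
    rw [if_pos ⟨rfl, a, b, hab, rfl⟩]
    exact Nat.one_pos

lemma holds_segmentAndPoint {n : ℕ} {pos pt : ℕ → ℕ} {s : RAM.State}
    (h : ∀ u < n, RAM.Written pos pt s u) : s.Holds (segmentAndPoint (n := n) pos pt) := by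
  intro u
  rcases h u u.isLt with ⟨h1, h2, h3, h4⟩ | ⟨h1, h2, h3, h4⟩
  · exact ⟨pointInterval (pt u), unitSegment (pos u), Set.pair_comm _ _, by
      rw [h1, h2, h3, h4]; exact ⟨rfl, rfl, rfl, rfl⟩⟩
  · exact ⟨unitSegment (pos u), pointInterval (pt u), rfl, by
      rw [h1, h2, h3, h4]; exact ⟨rfl, rfl, rfl, rfl⟩⟩

lemma runs_representationProgram (n : ℕ) (G : SimpleGraph (Fin n)) (hG : IsBoundedDegreeThree G) :
    ∃ (t : ℕ) (s : RAM.State) (f : Fin n → Set (NonemptyInterval ℝ)),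
      RAM.Runs RAM.representationProgram (RAM.graphInput G) t s ∧ t ≤ 200 * (n + 1) ^ 2 ∧
      s.Holds f ∧ IsSpecialRepresentation G f := by
  obtain ⟨v, _⟩ := hG.1
  obtain ⟨t, s, h1, h2, pos, pt, h3, h4, h5, h6⟩ := RAM.halts_representationProgram
    (isMatrix_graphInput G) v.pos hG.not_four_neighbors (s := RAM.graphInput G)
    (by simp [RAM.graphInput]) (fun x hx => by simp [RAM.graphInput, hx]) rfl
    (fun a ha => by simp [RAM.graphInput, ha])
  refine ⟨t, s, segmentAndPoint pos pt, h1, h2, holds_segmentAndPoint h3,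
    isSpecialRepresentation_segmentAndPoint
      (fun u v e => Fin.val_injective (h4 u u.isLt v v.isLt e)) (fun u => h5 u u.isLt)
      fun u v huv => ?_⟩
  rw [h6 u u.isLt v v.isLt fun e => huv (Fin.val_injective e)]
  exact SimpleGraph.map_adj_apply (f := Fin.valEmbedding)

/-! ### Transport along graph isomorphisms -/

section Transport

variable {V W : Type*} {G : SimpleGraph V} {H : SimpleGraph W}

lemma IsBoundedDegreeThree.of_iso (e : G ≃g H) (h : IsBoundedDegreeThree G) :
    IsBoundedDegreeThree H := by
  have key : ∀ v, (H.neighborSet (e v)).encard = (G.neighborSet v).encard := fun v =>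
    (Set.encard_congr (e.mapNeighborSet v)).symm
  obtain ⟨⟨v, hv⟩, h3⟩ := h
  refine ⟨⟨e v, by rw [key, hv]⟩, fun w => ?_⟩
  rw [← e.apply_symm_apply w, key]
  exact h3 _

lemma IsSpecialRepresentation.comp_iso (e : G ≃g H) {f : W → Set (NonemptyInterval ℝ)}
    (h : IsSpecialRepresentation H f) : IsSpecialRepresentation G fun v => f (e v) := by
  obtain ⟨⟨h1, h2, h3⟩, h4⟩ := h
  refine ⟨⟨fun u => h1 _, h2.comp e.injective, fun u w huw => ?_⟩, fun u => ?_⟩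
  · rw [← h3 _ _ (e.injective.ne huw), e.map_adj_iff]
  · have key : ∀ I, NoForeignEndpointInside f (e u) I →
        NoForeignEndpointInside (fun v => f (e v)) u I :=
      fun I hI v hv => hI _ (e.injective.ne hv)
    obtain ⟨I₁, I₂, hf, h5 | h5⟩ := h4 (e u)
    · exact ⟨I₁, I₂, hf, Or.inl ⟨h5.1, h5.2.1, h5.2.2.1, key _ h5.2.2.2⟩⟩
    · exact ⟨I₁, I₂, hf, Or.inr ⟨h5.1, h5.2.1, h5.2.2.1, key _ h5.2.2.2⟩⟩

end Transport

theorem lemma1 :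
    (∀ (V : Type*) [Finite V] (G : SimpleGraph V), IsBoundedDegreeThree G →
      ∃ f : V → Set (NonemptyInterval ℝ), IsSpecialRepresentation G f) ∧
    (∃ (p : RAM.Program) (q : Polynomial ℕ),
      ∀ (n : ℕ) (G : SimpleGraph (Fin n)), IsBoundedDegreeThree G →
        ∃ (t : ℕ) (s : RAM.State) (f : Fin n → Set (NonemptyInterval ℝ)),
          RAM.Runs p (RAM.graphInput G) t s ∧ t ≤ q.eval n ∧
          s.Holds f ∧ IsSpecialRepresentation G f) := by
  refine ⟨fun V _ G hG => ?_, RAM.representationProgram,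
    Polynomial.C 200 * (Polynomial.X + 1) ^ 2, fun n G hG => ?_⟩
  -- Existence is read off from the correctness of the algorithm on a numbered copy of the graph.
  · obtain ⟨n, ⟨e⟩⟩ := Finite.exists_equiv_fin V
    obtain ⟨_, _, f, _, _, _, hf⟩ :=
      runs_representationProgram n _ (hG.of_iso (SimpleGraph.Iso.map e G))
    exact ⟨_, hf.comp_iso (SimpleGraph.Iso.map e G)⟩
  · have := runs_representationProgram n G hG
    simpa using this
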